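/- A two-way quantum one-counter automaton (2Q1CA) over an input alphabet $\Sigma$ is given by a finite state set $Q$, an initial state $q_0\in Q$, disjoint sets $Q_{acc},Q_{rej}\subseteq Q$ of accepting and rejecting states, and transition amplitudes $\delta(q,\sigma,s,q',c,d)\in\mathbb{C}$, where $q,q'\in Q$, $\sigma\in\Sigma\cup\{\vdash,\dashv\}$ (with end-markers $\vdash,\dashv\notin\Sigma$), $s\in\{0,1\}$, $c\in\{-1,0,1\}$, $d\in\{\leftarrow,\downarrow,\rightarrow\}$. On an input $x$ the tape is circular and holds $w_x={\vdash}\,x\,{\dashv}$ on squares $0,\dots,|x|+1$. The configurations are the triples $(q,a,b)$ of a state, a counter value $a\in\mathbb{Z}$ and a head position $b$, and $$U_x|q,a,b\rangle=\sum_{q',c,d}\delta(q,w_x(b),\operatorname{sign}(a),q',c,d)\,|q',a+c,b+\mu(d)\rangle,$$ where $\operatorname{sign}(a)=0$ if $a=0$ and $1$ otherwise, $\mu(\leftarrow)=-1$, $\mu(\downarrow)=0$, $\mu(\rightarrow)=1$. It is required that $U_x$ is a unitary operator on the Hilbert space $\ell_2$ of the configurations for every input $x$, and that $\delta$ satisfies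 the local well-formedness conditions: for all $q_1,q_2$, the sum $\sum_{q',c_1,d_1,c_2,d_2}\overline{\delta(q_1,\sigma_1,s_1,q',c_1,d_1)}\,\delta(q_2,\sigma_2,s_2,q',c_2,d_2)$ over the terms with $c_1-c_2=-i$ and $\mu(d_1)-\mu(d_2)=-j$ vanishes for every $(i,j)\in\{(0,1),(0,2),(1,0),(1,\pm1),(1,\pm2),(2,0),(2,\pm1),(2,\pm2)\}$ and all $\sigma_1,\sigma_2,s_1,s_2$, where $\sigma_1=\sigma_2$ if $j=0$ and $s_1=s_2$ if $i=0$; and for $i=j=0$, $\sigma_1=\sigma_2$, $s_1=s_2$ it is $1$ if $q_1=q_2$ and $0$ otherwise. The computation starts in $|q_0,0,0\rangle$. In each step $U_x$ is applied, and then it is observed whether the state of the automaton is accepting, rejecting or neither; in the first two cases the computation halts with that result. Let $L=\{a^nb^{n^2}\mid n\ge 1\}\subseteq\{a,b\}^*$. There is an absolute constant $K$ such that for every integer $N\ge 2$ there is a 2Q1CA over the alphabet $\{a,b\}$ which accepts every $x\in L$ with probability $1$, rejects every $x\in\{a,b\}^*\setminus L$ with probability at least $1-1/N$, with probability exactly $1-1/N$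 if $x=a^mb^n$ with $m,n\ge1$ and $n\ne m^2$, and on every input $x\in\{a,b\}^*$ halts with certainty within $K\,N\max(|x|,1)$ steps. -/

import Mathlib

/-- A tape symbol: an input letter, the left end-marker, or the right end-marker. -/
inductive TapeSym (A : Type) : Type where
  | leftEnd : TapeSym A
  | rightEnd : TapeSym A
  | letter (x : A) : TapeSym A

/-- The head moves `←`, `↓`, `→`. -/
inductive HeadMove : Type where
  | left : HeadMove
  | stay : HeadMove
  | right : HeadMove
  deriving DecidableEq

instance : Fintype HeadMove where
  elems := {HeadMove.left, HeadMove.stay, HeadMove.right}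
  complete := by intro d; cases d <;> decide

/-- The displacement of the head: `-1`, `0`, `+1`. -/
def HeadMove.shift : HeadMove → ℤ
  | .left => -1
  | .stay => 0
  | .right => 1

/-- The counter status: `0` if the counter value is zero and `1` otherwise. -/
def counterStatus (k : ℤ) : Fin 2 := if k = 0 then 0 else 1

/-- The word written on the tape for the input `x`: `x` between the two end-markers. -/
def tapeWord {A : Type} (x : List A) : List (TapeSym A) :=
  TapeSym.leftEnd :: (x.map TapeSym.letter ++ [TapeSym.rightEnd])

/-- The squares of the tape for the input `x`. The tape has `|x| + 2` squares and is circular. -/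
abbrev TapePos {A : Type} (x : List A) : Type := ZMod (x.length + 2)

theorem tapePos_val_lt {A : Type} (x : List A) (b : TapePos x) :
    ZMod.val b < (tapeWord x).length := by
  have h := ZMod.val_lt b
  have hl : (tapeWord x).length = x.length + 2 := by simp [tapeWord]
  omega

/-- The symbol on square `b` of the tape for the input `x`. -/
def tapeSymAt {A : Type} (x : List A) (b : TapePos x) : TapeSym A :=
  (tapeWord x)[ZMod.val b]'(tapePos_val_lt x b)

/-- The data `(Q, A, δ, q₀, Q_acc, Q_rej)` of a two-way quantum one-counter automaton with input
alphabet `A`. The number `δ q σ s q' c d` is the amplitude with which the automaton, in state `q`,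
reading `σ`, with counter status `s`, enters the state `q'`, changes the counter by `c` (one of
`-1`, `0`, `1`) and moves its head by `d`. -/
structure QCounterData (A : Type) where
  Q : Type
  [fintypeQ : Fintype Q]
  δ : Q → TapeSym A → Fin 2 → Q → SignType → HeadMove → ℂ
  q₀ : Q
  acc : Set Q
  rej : Set Q

namespace QCounterData

attribute [instance] fintypeQ

variable {A : Type} (M : QCounterData A)

/-- Configurations on the input `x`: a state, a counter value and a head position. -/
abbrev Config (x : List A) : Type := M.Q × ℤ × TapePos x

open Classical in
/-- The time evolution operator on finite superpositions of configurations: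
`U |q, a, b⟩ = ∑_{q', c, d} δ(q, w_x(b), sign a, q', c, d) |q', a + c, b + μ(d)⟩`. -/
noncomputable def evolve (x : List A) : (M.Config x →₀ ℂ) →ₗ[ℂ] (M.Config x →₀ ℂ) :=
  Finsupp.linearCombination ℂ fun κ : M.Config x =>
    ∑ q' : M.Q, ∑ c : SignType, ∑ d : HeadMove,
      Finsupp.single (q', κ.2.1 + (c : ℤ), κ.2.2 + ((d.shift : ℤ) : TapePos x))
        (M.δ κ.1 (tapeSymAt x κ.2.2) (counterStatus κ.2.1) q' c d)

open Classical in
/-- The operator with `U |κ⟩ = M.evolve x |κ⟩` on basis vectors is a unitary operator on the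
Hilbert space `ℓ²` of the configurations, that is, `U* U = U U* = 1`. -/
def IsUnitaryOn (x : List A) : Prop :=
  ∃ U ∈ unitary (lp (fun _ : M.Config x => ℂ) 2 →L[ℂ] lp (fun _ : M.Config x => ℂ) 2),
    ∀ κ κ' : M.Config x,
      (U (lp.single 2 κ (1 : ℂ)) : M.Config x → ℂ) κ' = M.evolve x (Finsupp.single κ 1) κ'

open Classical HeadMove in
/-- The local well-formedness conditions on the transition amplitudes. -/
structure IsWellFormed : Prop where
  orthonormal : ∀ q₁ q₂ σ s,
    ∑ q', ∑ c, ∑ d, star (M.δ q₁ σ s q' c d) * M.δ q₂ σ s q' c d = if q₁ = q₂ then 1 else 0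
  counter0_head1 : ∀ q₁ q₂ σ₁ σ₂ s, ∑ q', ∑ c,
    (star (M.δ q₁ σ₁ s q' c left) * M.δ q₂ σ₂ s q' c stay
      + star (M.δ q₁ σ₁ s q' c stay) * M.δ q₂ σ₂ s q' c right) = 0
  counter0_head2 : ∀ q₁ q₂ σ₁ σ₂ s, ∑ q', ∑ c,
    star (M.δ q₁ σ₁ s q' c left) * M.δ q₂ σ₂ s q' c right = 0
  counter1_head0 : ∀ q₁ q₂ σ s₁ s₂, ∑ q', ∑ d,
    (star (M.δ q₁ σ s₁ q' (-1) d) * M.δ q₂ σ s₂ q' 0 d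
      + star (M.δ q₁ σ s₁ q' 0 d) * M.δ q₂ σ s₂ q' 1 d) = 0
  counter1_head1 : ∀ q₁ q₂ σ₁ σ₂ s₁ s₂, ∑ q',
    (star (M.δ q₁ σ₁ s₁ q' (-1) left) * M.δ q₂ σ₂ s₂ q' 0 stay
      + star (M.δ q₁ σ₁ s₁ q' (-1) stay) * M.δ q₂ σ₂ s₂ q' 0 right
      + star (M.δ q₁ σ₁ s₁ q' 0 left) * M.δ q₂ σ₂ s₂ q' 1 stay
      + star (M.δ q₁ σ₁ s₁ q' 0 stay) * M.δ q₂ σ₂ s₂ q' 1 right) = 0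
  counter1_head1' : ∀ q₁ q₂ σ₁ σ₂ s₁ s₂, ∑ q',
    (star (M.δ q₁ σ₁ s₁ q' (-1) right) * M.δ q₂ σ₂ s₂ q' 0 stay
      + star (M.δ q₁ σ₁ s₁ q' (-1) stay) * M.δ q₂ σ₂ s₂ q' 0 left
      + star (M.δ q₁ σ₁ s₁ q' 0 right) * M.δ q₂ σ₂ s₂ q' 1 stay
      + star (M.δ q₁ σ₁ s₁ q' 0 stay) * M.δ q₂ σ₂ s₂ q' 1 left) = 0
  counter1_head2 : ∀ q₁ q₂ σ₁ σ₂ s₁ s₂, ∑ q',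
    (star (M.δ q₁ σ₁ s₁ q' (-1) left) * M.δ q₂ σ₂ s₂ q' 0 right
      + star (M.δ q₁ σ₁ s₁ q' 0 left) * M.δ q₂ σ₂ s₂ q' 1 right) = 0
  counter1_head2' : ∀ q₁ q₂ σ₁ σ₂ s₁ s₂, ∑ q',
    (star (M.δ q₁ σ₁ s₁ q' (-1) right) * M.δ q₂ σ₂ s₂ q' 0 left
      + star (M.δ q₁ σ₁ s₁ q' 0 right) * M.δ q₂ σ₂ s₂ q' 1 left) = 0
  counter2_head0 : ∀ q₁ q₂ σ s₁ s₂, ∑ q', ∑ d,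
    star (M.δ q₁ σ s₁ q' (-1) d) * M.δ q₂ σ s₂ q' 1 d = 0
  counter2_head1 : ∀ q₁ q₂ σ₁ σ₂ s₁ s₂, ∑ q',
    (star (M.δ q₁ σ₁ s₁ q' (-1) left) * M.δ q₂ σ₂ s₂ q' 1 stay
      + star (M.δ q₁ σ₁ s₁ q' (-1) stay) * M.δ q₂ σ₂ s₂ q' 1 right) = 0
  counter2_head1' : ∀ q₁ q₂ σ₁ σ₂ s₁ s₂, ∑ q',
    (star (M.δ q₁ σ₁ s₁ q' (-1) right) * M.δ q₂ σ₂ s₂ q' 1 stay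
      + star (M.δ q₁ σ₁ s₁ q' (-1) stay) * M.δ q₂ σ₂ s₂ q' 1 left) = 0
  counter2_head2 : ∀ q₁ q₂ σ₁ σ₂ s₁ s₂, ∑ q',
    star (M.δ q₁ σ₁ s₁ q' (-1) left) * M.δ q₂ σ₂ s₂ q' 1 right = 0
  counter2_head2' : ∀ q₁ q₂ σ₁ σ₂ s₁ s₂, ∑ q',
    star (M.δ q₁ σ₁ s₁ q' (-1) right) * M.δ q₂ σ₂ s₂ q' 1 left = 0

open Classical in
/-- The unnormalized state after `t` steps if no observation so far has given `accept` or `reject`.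
It starts in state `q₀` with counter value `0` and with the head on the left end-marker. Each step
applies the evolution operator and then the projection to the non-halting configurations. -/
noncomputable def stateAt (x : List A) : ℕ → (M.Config x →₀ ℂ)
  | 0 => Finsupp.single (M.q₀, 0, 0) 1
  | t + 1 => (M.evolve x (stateAt x t)).filter fun κ => κ.1 ∉ M.acc ∧ κ.1 ∉ M.rej

open Classical in
/-- The probability that the outcome `accept` is observed in step `t + 1`: the squared norm of the
projection, to the accepting configurations, of the state after the transition. -/
noncomputable def acceptProbAt (x : List A) (t : ℕ) : ℝ :=
  ((M.evolve x (M.stateAt x t)).filter fun κ => κ.1 ∈ M.acc).sum fun _ z => ‖z‖ ^ 2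

open Classical in
/-- The probability that the outcome `reject` is observed in step `t + 1`. -/
noncomputable def rejectProbAt (x : List A) (t : ℕ) : ℝ :=
  ((M.evolve x (M.stateAt x t)).filter fun κ => κ.1 ∈ M.rej).sum fun _ z => ‖z‖ ^ 2

/-- The total probability that `M` accepts `x` is `p`. -/
def AcceptsWithProb (x : List A) (p : ℝ) : Prop := HasSum (M.acceptProbAt x) p

/-- The total probability that `M` rejects `x` is `p`. -/
def RejectsWithProb (x : List A) (p : ℝ) : Prop := HasSum (M.rejectProbAt x) p

/-- With certainty, `M` has halted on `x` after at most `T` steps: the state that remains after `T`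
steps without a halting outcome is zero. -/
def HaltsWithin (x : List A) (T : ℕ) : Prop := M.stateAt x T = 0

end QCounterData

/-- A two-way quantum one-counter automaton (2Q1CA) with input alphabet `A`. -/
structure TwoQ1CA (A : Type) extends QCounterData A where
  disjoint_acc_rej : Disjoint acc rej
  wellFormed : toQCounterData.IsWellFormed
  unitaryOn : ∀ x : List A, toQCounterData.IsUnitaryOn x

/-- The two-letter alphabet `{a, b}`. -/
inductive AB : Type where
  | a : AB
  | b : AB

/-- The word `a^m b^n`. -/
def wordAB (m n : ℕ) : List AB := List.replicate m AB.a ++ List.replicate n AB.b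

/-- The language `{a^n b^{n^2} | n ≥ 1}`. -/
def squareLanguage : Set (List AB) := {x | ∃ n : ℕ, 1 ≤ n ∧ x = wordAB n (n ^ 2)}

/-! The test `n = m ^ 2` on `a^m b^n` is an interference experiment. The automaton splits uniformly
into `N` branches. Branch `j` spends `j + 1` steps on each of the `m + n` letters in one sweep, and
`N - j` steps on each of `m ^ 2 + m` letter visits in nested loops over the block of `a`s. Two
branches `j`, `j'` differ in running time by `(n - m ^ 2) * (j - j')` (`branchTime_injective`,
`branchTime_sq`). A real symmetric unitary that exchanges the first basis vector and the uniform
vector serves both to split and to recombine. If `n = m ^ 2`, all branches arrive together and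
recombine into outcome `0`, which accepts. Otherwise they arrive at different times, do not
interfere, and each gives outcome `0` with conditional probability exactly `1 / N`.

The loops take about `N * m ^ 2` steps, which is not linear when `m` is large. So a deterministic
gauge computation first finds `k` with `4 ^ k ≤ n < 4 ^ (k + 1)` and brings `2 ^ (k + 1)` to the
counter. It does so by running through `1, 4, …, 4 ^ (k + 1)`, then replacing factors `4` by `3`,
then factors `3` by `2`; the times form geometric series, hence are linear in `n`
(`Gauge.steps_gauge`). If `m ≥ 2 ^ (k + 1)`, then `m ^ 2 > n`, and one toss of the `N`-sided coin
gives the required probability `1 - 1 / N`. Otherwise `m ^ 2 ≤ 4 * n`, the loops are affordable, and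
the gauge computation is run backwards to restore a clean configuration before the split.

Unitarity comes from reversibility. For each symbol and counter status the transition table is a
partial injection of a finite state set (`SquareState.prev_of_next`). It extends to a permutation,
which is followed by the coin matrix. As the state entered determines the counter change and the
head move, well-formedness and unitarity on configurations reduce to unitarity of these finite
matrices. -/

/-! ### Unitary operators on `ℓ²` from unitary blocks and a permutation. -/

section BlockUnitary

variable {Q B : Type} [Fintype Q] [DecidableEq Q]

open Classical in
/-- Applying a unitary matrix to each block `Q × {b}` and then permuting the basis vectors defines a
unitary operator on `ℓ²(Q × B)`. -/
theorem exists_unitary_blocks_perm (V : B → Matrix Q Q ℂ)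
    (hV : ∀ b, V b ∈ Matrix.unitaryGroup Q ℂ) (e : Q × B ≃ Q × B) :
    ∃ U ∈ unitary (lp (fun _ : Q × B => ℂ) 2 →L[ℂ] lp (fun _ : Q × B => ℂ) 2), ∀ κ : Q × B,
      U (lp.single 2 κ (1 : ℂ)) =
        ∑ q', V κ.2 q' κ.1 • lp.single 2 (e (q', κ.2)) (1 : ℂ) := by
  let E : HilbertBasis (Q × B) ℂ (lp (fun _ : Q × B => ℂ) 2) := default
  have hE : ∀ κ, lp.single 2 κ (1 : ℂ) = E κ := by
    intro κ
    rw [← HilbertBasis.repr_symm_single]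
    rfl
  let v : Q × B → lp (fun _ : Q × B => ℂ) 2 := fun κ => ∑ q', V κ.2 q' κ.1 • E (e (q', κ.2))
  have hEe : ∀ κ κ', inner ℂ (E (e κ)) (E (e κ')) = if κ = κ' then (1 : ℂ) else 0 := by
    intro κ κ'
    rw [orthonormal_iff_ite.1 E.orthonormal]
    simp
  have hon : Orthonormal ℂ v := by
    rw [orthonormal_iff_ite]
    rintro ⟨q₁, b₁⟩ ⟨q₂, b₂⟩
    simp only [v, sum_inner, inner_sum, inner_smul_left, inner_smul_right, hEe, Prod.mk.injEq]
    by_cases hb : b₁ = b₂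
    · subst hb
      have h := congrFun (congrFun (Matrix.mem_unitaryGroup_iff'.1 (hV b₁)) q₁) q₂
      rw [Matrix.mul_apply] at h
      simpa [Matrix.star_apply, Matrix.one_apply, mul_comm] using h
    · simp [hb]
  -- Orthonormality used `V* V = 1`; here `V V* = 1` writes every basis vector as a finite
  -- combination of the `v κ`.
  have hspan : ⊤ ≤ (Submodule.span ℂ (Set.range v)).topologicalClosure := by
    rw [← E.dense_span]
    refine Submodule.topologicalClosure_mono (Submodule.span_le.2 ?_)
    rintro _ ⟨κ, rfl⟩
    obtain ⟨⟨q, b⟩, rfl⟩ := e.surjective κ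
    have h : E (e (q, b)) = ∑ q₁, star (V b q q₁) • v (q₁, b) := by
      simp only [v, Finset.smul_sum, smul_smul]
      rw [Finset.sum_comm]
      simp only [← Finset.sum_smul]
      have h : ∀ q', ∑ q₁, star (V b q q₁) * V b q' q₁ = if q' = q then 1 else 0 := by
        intro q'
        have h := congrFun (congrFun (Matrix.mem_unitaryGroup_iff.1 (hV b)) q') q
        rw [Matrix.mul_apply] at h
        simpa [Matrix.star_apply, Matrix.one_apply, mul_comm] using h
      rw [Finset.sum_congr rfl fun q' _ => by rw [h q']]
      simp
    rw [SetLike.mem_coe, h]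
    exact Submodule.sum_mem _ fun q₁ _ =>
      Submodule.smul_mem _ _ (Submodule.subset_span ⟨_, rfl⟩)
  let W := HilbertBasis.mk hon hspan
  refine ⟨(Unitary.linearIsometryEquiv.symm W.repr.symm :
    unitary (lp (fun _ : Q × B => ℂ) 2 →L[ℂ] lp (fun _ : Q × B => ℂ) 2)), Subtype.property _, ?_⟩
  intro κ
  have h1 : W.repr.symm (lp.single 2 κ (1 : ℂ)) = v κ := by
    rw [HilbertBasis.repr_symm_single]
    exact congrFun (HilbertBasis.coe_mk hon hspan) κ
  simp only [hE]
  rw [← hE]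
  exact h1

end BlockUnitary

/-! ### Automata whose moves are determined by the state entered. -/

section Directed

variable {A Q : Type} [Fintype Q] (V : TapeSym A → Fin 2 → Matrix Q Q ℂ)
  (C : Q → SignType) (D : Q → HeadMove) (q₀ : Q) (acc rej : Set Q)

/-- The automaton in which the state entered determines the change of the counter and the head
move, and the symbol read and the counter status select the matrix that acts on the states. -/
noncomputable abbrev directedData : QCounterData A where
  Q := Q
  δ q σ s q' c d := if c = C q' ∧ d = D q' then V σ s q' q else 0
  q₀ := q₀
  acc := acc
  rej := rej

theorem directedData_sum_sum (q q₁ q₂ : Q) (σ₁ σ₂ : TapeSym A) (s₁ s₂ : Fin 2) :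
    ∑ c : SignType, ∑ d : HeadMove,
      star ((directedData V C D q₀ acc rej).δ q₁ σ₁ s₁ q c d) *
        (directedData V C D q₀ acc rej).δ q₂ σ₂ s₂ q c d =
      star (V σ₁ s₁ q q₁) * V σ₂ s₂ q q₂ := by
  rw [Finset.sum_eq_single (C q), Finset.sum_eq_single (D q)] <;>
    simp +contextual

/-- Amplitudes into the same state with different counter changes or head moves cannot both be
nonzero. So every condition except `orthonormal` holds term by term, and that one says that the
columns of `V σ s` are orthonormal. -/
theorem directedData_isWellFormed [DecidableEq Q]
    (hV : ∀ σ s, V σ s ∈ Matrix.unitaryGroup Q ℂ) :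
    (directedData V C D q₀ acc rej).IsWellFormed := by
  classical
  have key : ∀ (q : Q) (u w : ℂ) (c₁ c₂ : SignType) (d₁ d₂ : HeadMove), (c₁ ≠ c₂ ∨ d₁ ≠ d₂) →
      star (if c₁ = C q ∧ d₁ = D q then u else 0) * (if c₂ = C q ∧ d₂ = D q then w else 0) = 0 := by
    intro q u w c₁ c₂ d₁ d₂ h
    by_cases h1 : c₁ = C q ∧ d₁ = D q
    · rw [if_neg (c := c₂ = C q ∧ d₂ = D q), mul_zero]
      rintro ⟨h2, h3⟩
      exact h.elim (fun h => h (h1.1.trans h2.symm)) fun h => h (h1.2.trans h3.symm)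
    · rw [if_neg h1, star_zero, zero_mul]
  constructor
  case orthonormal =>
    intro q₁ q₂ σ s
    refine (Finset.sum_congr rfl fun q _ => directedData_sum_sum V C D q₀ acc rej q q₁ q₂ σ σ s s).trans ?_
    have h := congrFun (congrFun (Matrix.mem_unitaryGroup_iff'.1 (hV σ s)) q₁) q₂
    rw [Matrix.mul_apply] at h
    convert! h using 1
    rw [Matrix.one_apply]
    congr
  all_goals
    intros
    repeat refine Finset.sum_eq_zero fun _ _ => ?_
    dsimp only
    simp (decide := true) only [key, ne_eq, true_or, or_true, add_zero]

/-- The permutation of the configurations that performs the counter change and the head move. -/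
def shiftEquiv (x : List A) : Q × ℤ × TapePos x ≃ Q × ℤ × TapePos x where
  toFun κ := (κ.1, κ.2.1 + (C κ.1 : ℤ), κ.2.2 + (((D κ.1).shift : ℤ) : TapePos x))
  invFun κ := (κ.1, κ.2.1 - (C κ.1 : ℤ), κ.2.2 - (((D κ.1).shift : ℤ) : TapePos x))
  left_inv κ := by simp
  right_inv κ := by simp

open Classical in
theorem directedData_evolve_single (x : List A) (q : Q) (a : ℤ) (b : TapePos x) :
    (directedData V C D q₀ acc rej).evolve x (Finsupp.single (q, a, b) 1) =
      ∑ q' : Q, Finsupp.single (q', a + (C q' : ℤ), b + (((D q').shift : ℤ) : TapePos x))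
        (V (tapeSymAt x b) (counterStatus a) q' q) := by
  rw [QCounterData.evolve, Finsupp.linearCombination_single, one_smul]
  refine Finset.sum_congr rfl fun q' _ => ?_
  rw [Finset.sum_eq_single (C q'), Finset.sum_eq_single (D q')] <;>
    simp +contextual [directedData]

/-- One step acts by `V` on the states above each fixed pair of counter value and head position, and
then by the permutation `shiftEquiv`. -/
theorem directedData_isUnitaryOn [DecidableEq Q]
    (hV : ∀ σ s, V σ s ∈ Matrix.unitaryGroup Q ℂ) (x : List A) :
    (directedData V C D q₀ acc rej).IsUnitaryOn x := by
  classical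
  obtain ⟨U, hU, h⟩ := exists_unitary_blocks_perm
    (fun b : ℤ × TapePos x => V (tapeSymAt x b.2) (counterStatus b.1)) (fun b => hV _ _)
    (shiftEquiv C D x)
  refine ⟨U, hU, fun κ κ' => ?_⟩
  refine Eq.trans ?_ (congrArg (fun f : (Q × ℤ × TapePos x) →₀ ℂ => f κ')
    (directedData_evolve_single V C D q₀ acc rej x κ.1 κ.2.1 κ.2.2)).symm
  have h := h κ
  refine Eq.trans (congrArg (fun f : lp (fun _ : Q × ℤ × TapePos x => ℂ) 2 => U f κ') ?_)
    ((congrArg (fun f : lp (fun _ : Q × ℤ × TapePos x => ℂ) 2 => f κ') h).trans ?_)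
  · congr!
  simp only [lp.coeFn_sum, Finset.sum_apply, Finsupp.finsetSum_apply, lp.coeFn_smul, Pi.smul_apply,
    lp.single_apply, Finsupp.single_apply, Pi.single_apply, smul_eq_mul, mul_ite, mul_one, mul_zero]
  refine Finset.sum_congr rfl fun q' _ => ?_
  simp only [shiftEquiv, Equiv.coe_fn_mk, eq_comm]
  rfl

end Directed

/-! ### The `N`-sided quantum coin. -/

section UniformReflection

variable (N : ℕ) [NeZero N]

/-- The reflection of `ℂ^N` that exchanges the first basis vector and the uniform unit vector. -/
noncomputable def uniformReflection : Matrix (Fin N) (Fin N) ℂ := fun i j =>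
  (if i = j then 1 else 0) -
    ((if i = 0 then 1 else 0) - ((√N : ℝ) : ℂ)⁻¹) * ((if j = 0 then 1 else 0) - ((√N : ℝ) : ℂ)⁻¹) *
      (1 - ((√N : ℝ) : ℂ)⁻¹)⁻¹

variable {N}

theorem one_sub_inv_sqrt_ne_zero (hN : 2 ≤ N) : (1 - ((√N : ℝ) : ℂ)⁻¹) ≠ 0 := by
  rw [sub_ne_zero, ne_comm, Ne, inv_eq_one]
  norm_cast
  rw [Real.sqrt_eq_one]
  norm_cast
  omega

theorem uniformReflection_symm (i j : Fin N) :
    uniformReflection N i j = uniformReflection N j i := by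
  simp only [uniformReflection, eq_comm]
  ring

theorem uniformReflection_apply_zero (hN : 2 ≤ N) (i : Fin N) :
    uniformReflection N i 0 = ((√N : ℝ) : ℂ)⁻¹ := by
  simp only [uniformReflection, if_true]
  rw [mul_assoc, mul_inv_cancel₀ (one_sub_inv_sqrt_ne_zero hN)]
  ring

theorem uniformReflection_zero_apply (hN : 2 ≤ N) (j : Fin N) :
    uniformReflection N 0 j = ((√N : ℝ) : ℂ)⁻¹ := by
  rw [uniformReflection_symm, uniformReflection_apply_zero hN]

theorem star_uniformReflection (i j : Fin N) :
    star (uniformReflection N i j) = uniformReflection N i j := by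
  simp only [uniformReflection, Complex.star_def, map_sub, map_mul, map_inv₀, Complex.conj_ofReal,
    apply_ite (starRingEnd ℂ), map_one, map_zero]

/-- This is a Householder reflection. With `w = 1 / √N` and `u` the uniform unit vector, `e₀ - u`
has squared norm `2 * (1 - w)`, which is nonzero because `N ≥ 2`. -/
theorem uniformReflection_mem_unitaryGroup (hN : 2 ≤ N) :
    uniformReflection N ∈ Matrix.unitaryGroup (Fin N) ℂ := by
  rw [Matrix.mem_unitaryGroup_iff]
  ext i k
  rw [Matrix.mul_apply]
  simp only [Matrix.star_apply, star_uniformReflection]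
  have h0 := one_sub_inv_sqrt_ne_zero hN
  have hw : (N : ℂ) * (((√N : ℝ) : ℂ)⁻¹ * ((√N : ℝ) : ℂ)⁻¹) = 1 := by
    rw [← mul_inv, ← Complex.ofReal_mul, Real.mul_self_sqrt (Nat.cast_nonneg N)]
    have : (N : ℂ) ≠ 0 := Nat.cast_ne_zero.2 (NeZero.ne N)
    push_cast
    exact mul_inv_cancel₀ this
  simp only [uniformReflection, Matrix.one_apply]
  generalize ((√N : ℝ) : ℂ)⁻¹ = w at h0 hw
  -- The product is expanded so that each summand is a delta in `j` or a constant; the square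
  -- `(δ_{j0} - w) ^ 2` becomes `δ_{j0} * (1 - 2 * w) + w * w`.
  have h1 : ∀ j : Fin N, ((if i = j then (1 : ℂ) else 0) -
      ((if i = 0 then 1 else 0) - w) * ((if j = 0 then 1 else 0) - w) * (1 - w)⁻¹) *
      ((if k = j then 1 else 0) -
      ((if k = 0 then 1 else 0) - w) * ((if j = 0 then 1 else 0) - w) * (1 - w)⁻¹) =
      (if i = j then (if k = j then 1 else 0) else 0) -
      (if i = j then ((if k = 0 then 1 else 0) - w) * ((if j = 0 then 1 else 0) - w) * (1 - w)⁻¹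
        else 0) -
      (if k = j then ((if i = 0 then 1 else 0) - w) * ((if j = 0 then 1 else 0) - w) * (1 - w)⁻¹
        else 0) +
      ((if i = 0 then 1 else 0) - w) * ((if k = 0 then 1 else 0) - w) * (1 - w)⁻¹ * (1 - w)⁻¹ *
        ((if j = 0 then 1 - 2 * w else 0) + w * w) := by
    intro j
    split_ifs <;> ring
  rw [Finset.sum_congr rfl fun j _ => h1 j, Finset.sum_add_distrib, Finset.sum_sub_distrib,
    Finset.sum_sub_distrib, ← Finset.mul_sum, Finset.sum_add_distrib]
  simp only [Finset.sum_ite_eq, Finset.sum_ite_eq', Finset.mem_univ, if_true, Finset.sum_const,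
    Finset.card_univ, Fintype.card_fin, nsmul_eq_mul, hw]
  rw [show (1 - 2 * w + 1 : ℂ) = 2 * (1 - w) by ring]
  have h2 : (1 - w)⁻¹ * (2 * (1 - w)) = 2 := by field_simp
  rw [mul_assoc _ (1 - w)⁻¹ (2 * (1 - w)), h2]
  simp only [eq_comm]
  ring

theorem sum_norm_sq_uniformReflection (hN : 2 ≤ N) (j : Fin N) :
    ∑ l : Fin N, ‖uniformReflection N l j‖ ^ 2 = 1 := by
  have h := congrFun (congrFun
    (Matrix.mem_unitaryGroup_iff'.1 (uniformReflection_mem_unitaryGroup hN)) j) j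
  rw [Matrix.mul_apply, Matrix.one_apply_eq] at h
  have h1 : ∀ l, star (uniformReflection N) j l * uniformReflection N l j =
      ((‖uniformReflection N l j‖ ^ 2 : ℝ) : ℂ) := by
    intro l
    rw [Matrix.star_apply, Complex.star_def, Complex.conj_mul']
    push_cast
    rfl
  rw [Finset.sum_congr rfl fun l _ => h1 l] at h
  exact_mod_cast h

theorem norm_sq_inv_sqrt : ‖((√N : ℝ) : ℂ)⁻¹‖ ^ 2 = 1 / (N : ℝ) := by
  rw [norm_inv, Complex.norm_real, Real.norm_of_nonneg (Real.sqrt_nonneg _), inv_pow,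
    Real.sq_sqrt (Nat.cast_nonneg N), one_div]

/-- All entries of row `0` are `1 / √N`, so a basis vector that meets the coin alone gives outcome
`0` with probability `1 / N`, whichever vector it is. -/
theorem sum_norm_sq_uniformReflection_ne_zero (hN : 2 ≤ N) (j : Fin N) :
    ∑ l : Fin N, (if l = 0 then 0 else ‖uniformReflection N l j‖ ^ 2) = 1 - 1 / (N : ℝ) := by
  have h := sum_norm_sq_uniformReflection hN j
  have h1 : ∀ l : Fin N, ‖uniformReflection N l j‖ ^ 2 =
      (if l = 0 then 0 else ‖uniformReflection N l j‖ ^ 2) + if l = 0 then 1 / (N : ℝ) else 0 := by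
    intro l
    split_ifs with hl
    · rw [hl, uniformReflection_zero_apply hN, norm_sq_inv_sqrt, zero_add]
    · rw [add_zero]
  rw [Finset.sum_congr rfl fun l _ => h1 l, Finset.sum_add_distrib] at h
  simp only [Finset.sum_ite_eq', Finset.mem_univ, if_true] at h
  linarith

end UniformReflection

/-! ### The transition table of the gauge computation. -/

/-- The head move in the opposite direction. -/
def HeadMove.reverse : HeadMove → HeadMove
  | .left => .right
  | .stay => .stay
  | .right => .left

theorem HeadMove.shift_reverse (d : HeadMove) : d.reverse.shift = -d.shift := by
  cases d <;> rfl

/-- A round of the gauge computation multiplies the counter by `4`, by `3 / 4`, or by `2 / 3`. -/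
inductive Ratio : Type where
  | up
  | mid
  | low
  deriving DecidableEq

instance : Fintype Ratio where
  elems := {Ratio.up, Ratio.mid, Ratio.low}
  complete := by intro μ; cases μ <;> decide

/-- The divisor of a round. -/
def Ratio.div : Ratio → ℕ
  | .up => 1
  | .mid => 4
  | .low => 3

/-- The multiplier of a round. -/
def Ratio.mul : Ratio → ℕ
  | .up => 4
  | .mid => 3
  | .low => 2

/-- The states of the gauge computation, which finds the `k` with `4 ^ (k - 1) ≤ n < 4 ^ k` on the
block `b ^ n` and compares `2 ^ k` with the length of the block `a ^ m`. The residues are those of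
the counter modulo `12`. -/
inductive Gauge : Type where
  | enter
  | out (μ : Ratio) (r : ZMod 12)
  | into (μ : Ratio) (r : ZMod 12)
  | bounce (r : ZMod 12)
  | lift (r : ZMod 12)
  | compare (r : ZMod 12)
  deriving DecidableEq

namespace Gauge

instance : Finite Gauge := by
  let f : Gauge → Fin 6 × Ratio × ZMod 12
    | enter => (0, .up, 0)
    | out μ r => (1, μ, r)
    | into μ r => (2, μ, r)
    | bounce r => (3, .up, r)
    | lift r => (4, .up, r)
    | compare r => (5, .up, r)
  have : Function.Injective f := by
    intro x y h
    cases x <;> cases y <;> simp_all [f]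
  exact Finite.of_injective f this

/-- The change of the counter on entering a state. -/
def count : Gauge → SignType
  | enter => 0
  | out _ _ => -1
  | into _ _ => 1
  | bounce _ => 1
  | lift _ => 1
  | compare _ => -1

/-- The head move on entering a state. -/
def move : Gauge → HeadMove
  | enter => .left
  -- Here `r` is the residue after the decrement, so `r + 1` is the one before it.
  | out μ r => if (r + 1).val % μ.div = 0 then .right else .stay
  | into μ r => if r.val % μ.mul = 0 then .left else .stay
  | bounce _ => .left
  | lift _ => .right
  | compare _ => .left

/-- The partial transition function of the gauge computation. -/
def next : TapeSym AB → Fin 2 → Gauge → Option Gauge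
  | .letter .b, 0, out μ r => some (into μ (r + 1))
  | .letter .b, 1, enter => some enter
  | .letter .b, 1, out μ r => some (out μ (r - 1))
  | .letter .b, 1, into μ r => some (into μ (r + 1))
  | .letter .b, 1, bounce r => some (bounce (r + 1))
  | .letter .b, 1, lift r => some (compare r)
  | .letter .a, 1, enter => some (out .up 0)
  -- The residue at the end of a round selects the next round: `4` for powers of `4`; `0` for `3 ^ i
  -- * 4 ^ j` with `i, j ≥ 1`; `3`, `9` for powers of `3`; `0`, `6` for `2 ^ i * 3 ^ j` with `i, j ≥
  -- 1`; `2`, `4`, `8` for powers of `2`.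
  | .letter .a, 1, into .up r => if r = 4 then some (out .up 3) else none
  | .letter .a, 1, into .mid r =>
    if r = 0 then some (out .mid 11)
    else if r = 3 ∨ r = 9 then some (out .low (r - 1)) else none
  | .letter .a, 1, into .low r =>
    if r = 0 ∨ r = 6 then some (out .low (r - 1))
    -- Entering `compare r` directly would collide with the loop of `compare r` on the letter `a`;
    -- the detour over a `b` keeps the table injective.
    else if r = 2 ∨ r = 4 ∨ r = 8 then some (lift r) else none
  | .letter .a, 1, bounce r => if r = 4 then some (out .mid 3) else none
  | .letter .a, 1, compare r => some (compare r)
  -- Both statuses occur: the counter has already reached zero when `n = 4 ^ (k + 1) - 1`.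
  | .rightEnd, _, out .up r => some (bounce (r + 1))
  | _, _, _ => none

/-- The inverse of the partial transition function. -/
def prev : TapeSym AB → Fin 2 → Gauge → Option Gauge
  | .letter .b, 0, into μ r => some (out μ (r - 1))
  | .letter .b, 1, enter => some enter
  | .letter .b, 1, out μ r => some (out μ (r + 1))
  | .letter .b, 1, into μ r => some (into μ (r - 1))
  | .letter .b, 1, bounce r => some (bounce (r - 1))
  | .letter .b, 1, compare r => some (lift r)
  | .letter .a, 1, out .up r =>
    if r = 0 then some enter else if r = 3 then some (into .up 4) else none
  | .letter .a, 1, out .mid r =>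
    if r = 11 then some (into .mid 0) else if r = 3 then some (bounce 4) else none
  | .letter .a, 1, out .low r =>
    if r = 2 ∨ r = 8 then some (into .mid (r + 1))
    else if r = 5 ∨ r = 11 then some (into .low (r + 1)) else none
  | .letter .a, 1, lift r => if r = 2 ∨ r = 4 ∨ r = 8 then some (into .low r) else none
  | .letter .a, 1, compare r => some (compare r)
  | .rightEnd, _, bounce r => some (out .up (r - 1))
  | _, _, _ => none

/-- A finite check. It works because rounds that enter the same kind of state do so with different
residues, and it is what lets the gauge computation be undone. -/
theorem next_eq_some_iff (σ : TapeSym AB) (s : Fin 2) (p p' : Gauge) :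
    next σ s p = some p' ↔ prev σ s p' = some p := by
  have hs : ∀ s : Fin 2, s = 0 ∨ s = 1 := by decide
  have h1 : ∀ p p', next σ s p = some p' → prev σ s p' = some p := by
    intro p p' h
    rcases σ with _ | _ | ⟨_ | _⟩ <;> (obtain rfl | rfl := hs s) <;>
      rcases p with _ | ⟨_ | _ | _, r⟩ | ⟨_ | _ | _, r⟩ | r | r | r <;>
      simp only [next, reduceCtorEq, Option.some.injEq] at h <;>
      first
      | (subst h; simp [prev])
      | (split_ifs at h <;> (simp only [Option.some.injEq] at h; subst h; revert r; decide))
  have h2 : ∀ p p', prev σ s p' = some p → next σ s p = some p' := by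
    intro p p' h
    rcases σ with _ | _ | ⟨_ | _⟩ <;> (obtain rfl | rfl := hs s) <;>
      rcases p' with _ | ⟨_ | _ | _, r⟩ | ⟨_ | _ | _, r⟩ | r | r | r <;>
      simp only [prev, reduceCtorEq, Option.some.injEq] at h <;>
      first
      | (subst h; simp [next])
      | (split_ifs at h <;> (simp only [Option.some.injEq] at h; subst h; revert r; decide))
  exact ⟨h1 p p', h2 p p'⟩

end Gauge

/-! ### States and transition table of the whole automaton. -/

/-- The classical states of the automaton with `N` branches. -/
inductive Core (N : ℕ) : Type where
  | start
  | skipA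
  | probe
  | skipB
  | fail
  | fwd (p : Gauge)
  | bwd (p : Gauge)
  | scan (j r : Fin N)
  | back (j : Fin N)
  | bump (j : Fin N)
  | down (j r : Fin N)
  | up (j r : Fin N)
  deriving DecidableEq

/-- The places where the automaton branches: when the loops start, when they end, and when the
gauge computation fails. -/
inductive Coin : Type where
  | split
  | final
  | short (r : ZMod 12)
  deriving DecidableEq

/-- The states of the automaton with `N` branches. -/
abbrev SquareState (N : ℕ) : Type := Core N ⊕ Coin × Fin N

instance : Finite Coin := by
  let f : Coin → Fin 3 × ZMod 12
    | .split => (0, 0)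
    | .final => (1, 0)
    | .short r => (2, r)
  have : Function.Injective f := by
    intro x y h
    cases x <;> cases y <;> simp_all [f]
  exact Finite.of_injective f this

instance (N : ℕ) : Finite (Core N) := by
  let f : Core N → Fin 12 × Option Gauge × Option (Fin N × Fin N)
    | .start => (0, none, none)
    | .skipA => (1, none, none)
    | .probe => (2, none, none)
    | .skipB => (3, none, none)
    | .fail => (4, none, none)
    | .fwd p => (5, some p, none)
    | .bwd p => (6, some p, none)
    | .scan j r => (7, none, some (j, r))
    | .back j => (8, none, some (j, j))
    | .bump j => (9, none, some (j, j))
    | .down j r => (10, none, some (j, r))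
    | .up j r => (11, none, some (j, r))
  have : Function.Injective f := by
    intro x y h
    cases x <;> cases y <;> simp_all [f]
  exact Finite.of_injective f this

noncomputable instance : Fintype Coin := Fintype.ofFinite _

noncomputable instance (N : ℕ) : Fintype (Core N) := Fintype.ofFinite _

section Tick

variable {N : ℕ} [NeZero N]

/-- One step of the clock that runs through `0, …, w` cyclically. -/
def tick (w r : Fin N) : Option (Fin N) :=
  if h : r < w then some ⟨r + 1, lt_of_le_of_lt (Nat.succ_le_of_lt h) w.2⟩
  else if r = w then some 0 else none

/-- One step of the clock backwards. -/
def untick (w r : Fin N) : Option (Fin N) :=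
  if r = 0 then some w
  else if r ≤ w then some ⟨r - 1, lt_of_le_of_lt (Nat.sub_le _ _) r.2⟩ else none

theorem untick_of_tick {w r r' : Fin N} (h : tick w r = some r') : untick w r' = some r := by
  rw [tick] at h
  split_ifs at h with h1 h2
  · obtain rfl := Option.some.inj h
    have h3 : (⟨r + 1, lt_of_le_of_lt (Nat.succ_le_of_lt h1) w.2⟩ : Fin N) ≠ 0 := by
      intro h
      have := congrArg Fin.val h
      simp at this
    have h4 : (⟨r + 1, lt_of_le_of_lt (Nat.succ_le_of_lt h1) w.2⟩ : Fin N) ≤ w := h1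
    rw [untick, if_neg h3, if_pos h4]
    rfl
  · obtain rfl := Option.some.inj h
    rw [untick, if_pos rfl, h2]

theorem tick_self (w : Fin N) : tick w w = some 0 := by simp [tick]

end Tick

namespace SquareState

open Core Coin Sum

variable {N : ℕ} [NeZero N]

/-- The change of the counter on entering a state. -/
def count : SquareState N → SignType
  | inl probe => 1
  | inl (fwd p) => p.count
  | inl (bwd p) => -p.count
  | inl (bump _) => 1
  | inl (down _ r) => if r = 0 then -1 else 0
  | inl (up _ r) => if r = 0 then 1 else 0
  -- This removes the unit that `probe` put on the counter, so that the branches start with counter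
  -- zero.
  | inr (split, _) => -1
  | _ => 0

/-- The head move on entering a state. -/
def move : SquareState N → HeadMove
  | inl skipA => .right
  | inl probe => .left
  | inl skipB => .right
  | inl (fwd p) => p.move
  | inl (bwd p) => p.move.reverse
  | inl (scan _ r) => if r = 0 then .left else .stay
  | inl (back _) => .right
  | inl (down _ r) => if r = 0 then .left else .stay
  | inl (up _ r) => if r = 0 then .right else .stay
  | _ => .stay

/-- The partial transition function, before the branching. -/
def next : TapeSym AB → Fin 2 → SquareState N → Option (SquareState N)
  | .leftEnd, 0 => fun
    | inl start => some (inl skipA)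
    | inl (scan j r) => if r = 0 then some (inl (back j)) else none
    | inl (down j r) => if r = 0 then some (inr (final, j)) else none
    | inl (fwd (.compare r)) => some (inr (short r, 0))
    | _ => none
  | .leftEnd, 1 => fun
    | inl probe => some (inl fail)
    | inl (fwd (.compare r)) => some (inl (bwd (.compare r)))
    | _ => none
  | .rightEnd, 0 => fun
    | inl skipA => some (inl fail)
    | inr (split, j) => some (inl (scan j 0))
    | inl (fwd p) => (Gauge.next .rightEnd 0 p).map (inl ∘ fwd)
    | inl (bwd p) => (Gauge.prev .rightEnd 0 p).map (inl ∘ bwd)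
    | _ => none
  | .rightEnd, 1 => fun
    | inl skipB => some (inl (fwd .enter))
    | inl (bwd .enter) => some (inr (split, 0))
    | inl (fwd p) => (Gauge.next .rightEnd 1 p).map (inl ∘ fwd)
    | inl (bwd p) => (Gauge.prev .rightEnd 1 p).map (inl ∘ bwd)
    | _ => none
  | .letter .a, 0 => fun
    | inl skipA => some (inl skipA)
    | inl (scan j r) => (tick j r).map fun r => inl (scan j r)
    | inl (back j) => some (inl (back j))
    -- With counter zero a restart of the clock would decrement below zero; the descent turns into
    -- an ascent instead, after a full clock period.
    | inl (down j r) =>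
      if r = j.rev then some (inl (up j 0)) else (tick j.rev r).map fun r => inl (down j r)
    | inl (fwd (.compare r)) => some (inr (short r, 0))
    | _ => none
  | .letter .a, 1 => fun
    | inl probe => some (inl skipB)
    | inl skipB => some (inl fail)
    | inl (fwd p) => (Gauge.next (.letter .a) 1 p).map (inl ∘ fwd)
    | inl (bwd p) => (Gauge.prev (.letter .a) 1 p).map (inl ∘ bwd)
    | inl (down j r) => (tick j.rev r).map fun r => inl (down j r)
    | inl (up j r) => (tick j.rev r).map fun r => inl (up j r)
    | _ => none
  | .letter .b, 0 => fun
    | inl skipA => some (inl probe)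
    | inl (fwd p) => (Gauge.next (.letter .b) 0 p).map (inl ∘ fwd)
    | inl (bwd p) => (Gauge.prev (.letter .b) 0 p).map (inl ∘ bwd)
    | inl (scan j r) => (tick j r).map fun r => inl (scan j r)
    | inl (back j) => some (inl (bump j))
    | _ => none
  | .letter .b, 1 => fun
    | inl skipB => some (inl skipB)
    | inl (fwd p) => (Gauge.next (.letter .b) 1 p).map (inl ∘ fwd)
    | inl (bwd p) => (Gauge.prev (.letter .b) 1 p).map (inl ∘ bwd)
    | inl (up j r) => if r = 0 then some (inl (bump j)) else none
    | inl (bump j) => some (inl (down j 0))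
    | _ => none

/-- A left inverse of the partial transition function. -/
def prev : TapeSym AB → Fin 2 → SquareState N → Option (SquareState N)
  | .leftEnd, 0 => fun
    | inl skipA => some (inl start)
    | inl (back j) => some (inl (scan j 0))
    | inr (final, j) => some (inl (down j 0))
    | inr (short r, _) => some (inl (fwd (.compare r)))
    | _ => none
  | .leftEnd, 1 => fun
    | inl fail => some (inl probe)
    | inl (bwd (.compare r)) => some (inl (fwd (.compare r)))
    | _ => none
  | .rightEnd, 0 => fun
    | inl fail => some (inl skipA)
    | inl (scan j _) => some (inr (split, j))
    | inl (fwd p) => (Gauge.prev .rightEnd 0 p).map (inl ∘ fwd)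
    | inl (bwd p) => (Gauge.next .rightEnd 0 p).map (inl ∘ bwd)
    | _ => none
  | .rightEnd, 1 => fun
    | inl (fwd .enter) => some (inl skipB)
    | inr (split, _) => some (inl (bwd .enter))
    | inl (fwd p) => (Gauge.prev .rightEnd 1 p).map (inl ∘ fwd)
    | inl (bwd p) => (Gauge.next .rightEnd 1 p).map (inl ∘ bwd)
    | _ => none
  | .letter .a, 0 => fun
    | inl skipA => some (inl skipA)
    | inl (scan j r) => (untick j r).map fun r => inl (scan j r)
    | inl (back j) => some (inl (back j))
    | inl (down j r) => (untick j.rev r).map fun r => inl (down j r)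
    | inl (up j _) => some (inl (down j j.rev))
    | inr (short r, _) => some (inl (fwd (.compare r)))
    | _ => none
  | .letter .a, 1 => fun
    | inl skipB => some (inl probe)
    | inl fail => some (inl skipB)
    | inl (fwd p) => (Gauge.prev (.letter .a) 1 p).map (inl ∘ fwd)
    | inl (bwd p) => (Gauge.next (.letter .a) 1 p).map (inl ∘ bwd)
    | inl (down j r) => (untick j.rev r).map fun r => inl (down j r)
    | inl (up j r) => (untick j.rev r).map fun r => inl (up j r)
    | _ => none
  | .letter .b, 0 => fun
    | inl probe => some (inl skipA)
    | inl (fwd p) => (Gauge.prev (.letter .b) 0 p).map (inl ∘ fwd)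
    | inl (bwd p) => (Gauge.next (.letter .b) 0 p).map (inl ∘ bwd)
    | inl (scan j r) => (untick j r).map fun r => inl (scan j r)
    | inl (bump j) => some (inl (back j))
    | _ => none
  | .letter .b, 1 => fun
    | inl skipB => some (inl skipB)
    | inl (fwd p) => (Gauge.prev (.letter .b) 1 p).map (inl ∘ fwd)
    | inl (bwd p) => (Gauge.next (.letter .b) 1 p).map (inl ∘ bwd)
    | inl (bump j) => some (inl (up j 0))
    | inl (down j _) => some (inl (bump j))
    | _ => none

/-- On the right end-marker `fwd enter` is reserved as the successor of `skipB`; a second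
predecessor would break injectivity. -/
theorem _root_.Gauge.next_rightEnd_ne_enter (s : Fin 2) (p : Gauge) :
    Gauge.next .rightEnd s p ≠ some .enter := by
  rw [Ne, Gauge.next_eq_some_iff]
  simp [Gauge.prev]

theorem prev_of_next {σ : TapeSym AB} {s : Fin 2} {q q' : SquareState N}
    (h : next σ s q = some q') : prev σ s q' = some q := by
  have hs : ∀ s : Fin 2, s = 0 ∨ s = 1 := by decide
  have hf : ∀ σ s p p', Gauge.next σ s p = some p' → Gauge.prev σ s p' = some p :=
    fun σ s p p' => (Gauge.next_eq_some_iff σ s p p').1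
  have hb : ∀ σ s p p', Gauge.prev σ s p = some p' → Gauge.next σ s p' = some p :=
    fun σ s p p' => (Gauge.next_eq_some_iff σ s p' p).2
  rcases σ with _ | _ | ⟨_ | _⟩ <;> (obtain rfl | rfl := hs s) <;> simp only [next] at h <;>
    split at h <;> (try split_ifs at h) <;>
    simp only [Option.some.injEq, reduceCtorEq, Option.map_eq_some_iff, Function.comp] at h
  all_goals
    first
    | (subst h; simp [prev, *])
    | (obtain ⟨p', h1, rfl⟩ := h
       first
       | (simp [prev, untick_of_tick h1])
       | (simp [prev, hf _ _ _ _ h1]; done)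
       | (simp [prev, hb _ _ _ _ h1])
       | (cases p' with
          | enter => exact absurd h1 (Gauge.next_rightEnd_ne_enter 1 _)
          | _ => simp [prev, hf _ _ _ _ h1]))

end SquareState

/-! ### Counted runs and the extension of partial injections. -/

/-- `IterRel r k a b` says that `b` can be reached from `a` in exactly `k` steps of `r`. -/
inductive IterRel {α : Type} (r : α → α → Prop) : ℕ → α → α → Prop where
  | refl (a : α) : IterRel r 0 a a
  | head {k : ℕ} {a b c : α} (h : r a b) (h' : IterRel r k b c) : IterRel r (k + 1) a c

namespace IterRel

variable {α β : Type} {r : α → α → Prop} {s : β → β → Prop} {a b c : α} {k l : ℕ}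

theorem single (h : r a b) : IterRel r 1 a b := head h (refl b)

theorem trans (h : IterRel r k a b) (h' : IterRel r l b c) : IterRel r (k + l) a c := by
  induction h with
  | refl => simpa using h'
  | head h _ ih => rw [Nat.add_right_comm]; exact head h (ih h')

theorem tail (h : IterRel r k a b) (h' : r b c) : IterRel r (k + 1) a c :=
  h.trans (single h')

theorem of_eq (h : IterRel r k a b) (hk : k = l) (hb : b = c) : IterRel r l a c := hk ▸ hb ▸ h

theorem map {f : α → β} (hf : ∀ a b, r a b → s (f a) (f b)) (h : IterRel r k a b) :
    IterRel s k (f a) (f b) := by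
  induction h with
  | refl => exact refl _
  | head h _ ih => exact head (hf _ _ h) ih

theorem map_reverse {f : α → β} (hf : ∀ a b, r a b → s (f b) (f a)) (h : IterRel r k a b) :
    IterRel s k (f b) (f a) := by
  induction h with
  | refl => exact refl _
  | head h _ ih => exact ih.tail (hf _ _ h)

end IterRel

/-- The left inverse makes `f` a bijection from its domain to its range, and on a finite type the
complements of these have equal size. -/
theorem exists_perm_extending {α : Type} [Finite α] (f g : α → Option α)
    (h : ∀ a b, f a = some b → g b = some a) :
    ∃ π : Equiv.Perm α, ∀ a b, f a = some b → π a = b := by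
  classical
  have := Fintype.ofFinite α
  let e : {a // ∃ b, f a = some b} ≃ {b // ∃ a, f a = some b} :=
    { toFun := fun a => ⟨a.2.choose, a.1, a.2.choose_spec⟩
      invFun := fun b => ⟨b.2.choose, b.1, b.2.choose_spec⟩
      left_inv := by
        rintro ⟨a, ha⟩
        have hb : ∃ a', f a' = some ha.choose := ⟨a, ha.choose_spec⟩
        exact Subtype.ext (Option.some.inj ((h _ _ hb.choose_spec).symm.trans
          (h _ _ ha.choose_spec)))
      right_inv := by
        rintro ⟨b, hb⟩
        have ha : ∃ b', f hb.choose = some b' := ⟨b, hb.choose_spec⟩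
        exact Subtype.ext (Option.some.inj (ha.choose_spec.symm.trans hb.choose_spec)) }
  refine ⟨e.extendSubtype, fun a b hab => ?_⟩
  rw [Equiv.extendSubtype_apply_of_mem e a ⟨b, hab⟩]
  have ha : ∃ b', f a = some b' := ⟨b, hab⟩
  exact Option.some.inj (ha.choose_spec.symm.trans hab)

/-! ### Halting times and outcome probabilities. -/

namespace QCounterData

variable {A : Type} (M : QCounterData A) (x : List A)

open Classical in
/-- The unnormalized state after a step without a halting outcome. -/
noncomputable def surviving : (M.Config x →₀ ℂ) →ₗ[ℂ] (M.Config x →₀ ℂ) where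
  toFun ψ := (M.evolve x ψ).filter fun κ => κ.1 ∉ M.acc ∧ κ.1 ∉ M.rej
  map_add' ψ φ := by rw [map_add, Finsupp.filter_add]
  map_smul' z ψ := by rw [map_smul, Finsupp.filter_smul]; rfl

open Classical in
/-- The halting part of the state after a step. -/
noncomputable def halting : (M.Config x →₀ ℂ) →ₗ[ℂ] (M.Config x →₀ ℂ) where
  toFun ψ := (M.evolve x ψ).filter fun κ => κ.1 ∈ M.acc ∨ κ.1 ∈ M.rej
  map_add' ψ φ := by rw [map_add, Finsupp.filter_add]
  map_smul' z ψ := by rw [map_smul, Finsupp.filter_smul]; rfl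

theorem stateAt_eq_pow (t : ℕ) :
    M.stateAt x t = (M.surviving x ^ t) (Finsupp.single (M.q₀, 0, 0) 1) := by
  induction t with
  | zero => rfl
  | succ t ih => rw [pow_succ', Module.End.mul_apply, ← ih]; rfl

/-- From the state `ψ` on, the outcomes occur at the times `τ j`, with the unnormalized halting
parts `η j`, and nothing survives after the time `T`. -/
def HaltsAs {J : Type} [Fintype J] (ψ : M.Config x →₀ ℂ) (T : ℕ) (τ : J → ℕ)
    (η : J → M.Config x →₀ ℂ) : Prop :=
  (∀ t, T ≤ t → (M.surviving x ^ t) ψ = 0) ∧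
    ∀ t, M.halting x ((M.surviving x ^ t) ψ) = ∑ j, if t = τ j then η j else 0

/-- A deterministic step that does not halt. -/
def Step (κ κ' : M.Config x) : Prop :=
  M.evolve x (Finsupp.single κ 1) = Finsupp.single κ' 1 ∧ κ'.1 ∉ M.acc ∧ κ'.1 ∉ M.rej

variable {M x} {J : Type} [Fintype J] {ψ φ : M.Config x →₀ ℂ} {T : ℕ} {τ : J → ℕ}
  {η : J → M.Config x →₀ ℂ}

theorem HaltsAs.step (h : M.HaltsAs x φ T τ η) (h0 : M.halting x ψ = 0)
    (h1 : M.surviving x ψ = φ) : M.HaltsAs x ψ (T + 1) (fun j => τ j + 1) η := by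
  constructor
  · intro t ht
    obtain ⟨t, rfl⟩ : ∃ t', t = t' + 1 := ⟨t - 1, by omega⟩
    rw [pow_succ, Module.End.mul_apply, h1]
    exact h.1 t (by omega)
  · rintro (_ | t)
    · simp [h0]
    · rw [pow_succ, Module.End.mul_apply, h1, h.2]
      simp

theorem HaltsAs.of_steps {κ κ' : M.Config x} {k : ℕ} (hk : IterRel (M.Step x) k κ κ')
    (h : M.HaltsAs x (Finsupp.single κ' 1) T τ η) :
    M.HaltsAs x (Finsupp.single κ 1) (T + k) (fun j => τ j + k) η := by
  classical
  induction hk with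
  | refl => exact h
  | head hs _ ih =>
    refine (ih h).step ?_ ?_
    · change (M.evolve x _).filter _ = 0
      rw [hs.1, Finsupp.filter_single_of_neg]
      rintro (h | h)
      exacts [hs.2.1 h, hs.2.2 h]
    · change (M.evolve x _).filter _ = _
      rw [hs.1, Finsupp.filter_single_of_pos]
      exact hs.2

theorem HaltsAs.of_evolve {κ : M.Config x} {L : Type} [Fintype L] {k : L → M.Config x} {u : L → ℂ}
    (h : M.evolve x (Finsupp.single κ 1) = ∑ l, Finsupp.single (k l) (u l))
    (hk : ∀ l, (k l).1 ∈ M.acc ∨ (k l).1 ∈ M.rej) :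
    M.HaltsAs x (Finsupp.single κ 1) 1 (fun _ : Unit => 0)
      (fun _ => ∑ l, Finsupp.single (k l) (u l)) := by
  classical
  have h1 : M.surviving x (Finsupp.single κ 1) = 0 := by
    change (M.evolve x _).filter _ = 0
    rw [h, Finsupp.filter_eq_zero_iff]
    intro κ' hκ'
    rw [Finsupp.finsetSum_apply]
    refine Finset.sum_eq_zero fun l _ => Finsupp.single_eq_of_ne ?_
    rintro rfl
    exact (hk l).elim hκ'.1 hκ'.2
  have h2 : M.halting x (Finsupp.single κ 1) = ∑ l, Finsupp.single (k l) (u l) := by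
    change (M.evolve x _).filter _ = _
    rw [h, Finsupp.filter_eq_self_iff]
    intro κ' hκ'
    by_contra hne
    apply hκ'
    rw [Finsupp.finsetSum_apply]
    refine Finset.sum_eq_zero fun l _ => Finsupp.single_eq_of_ne ?_
    rintro rfl
    exact hne (hk l)
  constructor
  · intro t ht
    obtain ⟨t, rfl⟩ : ∃ t', t = t' + 1 := ⟨t - 1, by omega⟩
    rw [pow_succ, Module.End.mul_apply, h1, map_zero]
  · rintro (_ | t)
    · simpa using h2
    · rw [pow_succ, Module.End.mul_apply, h1, map_zero, map_zero]
      simp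

/-- Evolution and projection are linear, so superposed runs keep their own halting times and only
their halting amplitudes add. -/
theorem HaltsAs.sum {ψ : J → M.Config x →₀ ℂ} (α : J → ℂ)
    (h : ∀ j, M.HaltsAs x (ψ j) T (fun _ : Unit => τ j) (fun _ => η j)) :
    M.HaltsAs x (∑ j, α j • ψ j) T τ (fun j => α j • η j) := by
  constructor
  · intro t ht
    rw [map_sum]
    exact Finset.sum_eq_zero fun j _ => by rw [map_smul, (h j).1 t ht, smul_zero]
  · intro t
    simp only [map_sum, map_smul]
    refine Finset.sum_congr rfl fun j _ => ?_
    rw [(h j).2 t]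
    simp

theorem HaltsAs.mono (h : M.HaltsAs x ψ T τ η) {T' : ℕ} (hT : T ≤ T') : M.HaltsAs x ψ T' τ η :=
  ⟨fun t ht => h.1 t (hT.trans ht), h.2⟩

theorem HaltsAs.haltsWithin (h : M.HaltsAs x (Finsupp.single (M.q₀, 0, 0) 1) T τ η) {T' : ℕ}
    (hT : T ≤ T') : M.HaltsWithin x T' := by
  rw [HaltsWithin, stateAt_eq_pow]
  exact h.1 T' hT

open Classical in
/-- The squared norm of the projection of `ψ` to the configurations with a state in `S`. -/
noncomputable def weight (S : Set M.Q) (ψ : M.Config x →₀ ℂ) : ℝ :=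
  (ψ.filter fun κ => κ.1 ∈ S).sum fun _ z => ‖z‖ ^ 2

theorem weight_zero (S : Set M.Q) : weight S (0 : M.Config x →₀ ℂ) = 0 := by
  simp [weight, Finsupp.filter_zero]

open Classical in
theorem weight_sum_single (S : Set M.Q) {L : Type} [Fintype L] {k : L → M.Config x}
    (hk : Function.Injective k) (u : L → ℂ) :
    weight S (∑ l, Finsupp.single (k l) (u l)) =
      ∑ l, if (k l).1 ∈ S then ‖u l‖ ^ 2 else 0 := by
  have h : (∑ l, Finsupp.single (k l) (u l)).filter (fun κ => κ.1 ∈ S) =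
      ∑ l, Finsupp.single (k l) (if (k l).1 ∈ S then u l else 0) := by
    ext κ
    rw [Finsupp.filter_apply, Finsupp.finsetSum_apply, Finsupp.finsetSum_apply]
    split_ifs with hS
    · refine Finset.sum_congr rfl fun l _ => ?_
      rw [Finsupp.single_apply, Finsupp.single_apply]
      by_cases h1 : k l = κ
      · rw [if_pos h1, if_pos h1, if_pos (h1 ▸ hS)]
      · rw [if_neg h1, if_neg h1]
    · refine (Finset.sum_eq_zero fun l _ => ?_).symm
      rw [Finsupp.single_apply]
      split_ifs with h1 h2
      · exact absurd (h1 ▸ h2) hS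
      all_goals rfl
  rw [weight, h]
  have h2 : ∀ v : L → ℂ, ∑ l, Finsupp.single (k l) (v l) =
      Finsupp.embDomain ⟨k, hk⟩ (Finsupp.equivFunOnFinite.symm v) := by
    intro v
    rw [Finsupp.embDomain_eq_mapDomain, Finsupp.mapDomain, Finsupp.sum_fintype]
    · rfl
    · simp
  rw [h2, Finsupp.sum_embDomain, Finsupp.sum_fintype]
  · refine Finset.sum_congr rfl fun l _ => ?_
    rw [Finsupp.equivFunOnFinite_symm_apply_apply]
    split_ifs <;> simp
  · simp

theorem acceptProbAt_eq_weight (t : ℕ) : M.acceptProbAt x t =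
    weight M.acc (M.halting x ((M.surviving x ^ t) (Finsupp.single (M.q₀, 0, 0) 1))) := by
  classical
  rw [acceptProbAt, weight, ← stateAt_eq_pow]
  congr 1
  ext κ
  simp only [halting, LinearMap.coe_mk, AddHom.coe_mk, Finsupp.filter_apply]
  split_ifs with h1 h2
  · rfl
  · exact absurd (Or.inl h1) h2
  · rfl

theorem rejectProbAt_eq_weight (t : ℕ) : M.rejectProbAt x t =
    weight M.rej (M.halting x ((M.surviving x ^ t) (Finsupp.single (M.q₀, 0, 0) 1))) := by
  classical
  rw [rejectProbAt, weight, ← stateAt_eq_pow]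
  congr 1
  ext κ
  simp only [halting, LinearMap.coe_mk, AddHom.coe_mk, Finsupp.filter_apply]
  split_ifs with h1 h2
  · rfl
  · exact absurd (Or.inr h1) h2
  · rfl

/-- Simultaneous arrival: amplitudes are added before the norm is taken. -/
theorem HaltsAs.acceptsWithProb (h : M.HaltsAs x (Finsupp.single (M.q₀, 0, 0) 1) T τ η) (t₀ : ℕ)
    (hτ : ∀ j, τ j = t₀) : M.AcceptsWithProb x (weight M.acc (∑ j, η j)) := by
  have h1 : M.acceptProbAt x = fun t => if t = t₀ then weight M.acc (∑ j, η j) else 0 := by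
    funext t
    rw [acceptProbAt_eq_weight, h.2]
    simp only [hτ]
    split_ifs
    · rfl
    · rw [Finset.sum_const_zero, weight_zero]
  rw [AcceptsWithProb, h1]
  exact hasSum_ite_eq t₀ _

/-- Distinct arrival times: each halting part is observed alone, so probabilities are added. -/
theorem HaltsAs.rejectsWithProb (h : M.HaltsAs x (Finsupp.single (M.q₀, 0, 0) 1) T τ η)
    (hτ : Function.Injective τ) : M.RejectsWithProb x (∑ j, weight M.rej (η j)) := by
  have h1 : M.rejectProbAt x = fun t => ∑ j, if t = τ j then weight M.rej (η j) else 0 := by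
    funext t
    rw [rejectProbAt_eq_weight, h.2]
    by_cases ht : ∃ j, t = τ j
    · obtain ⟨j, rfl⟩ := ht
      rw [Finset.sum_eq_single j, Finset.sum_eq_single j, if_pos rfl, if_pos rfl]
      · exact fun i _ hi => if_neg fun h => hi (hτ h.symm)
      · simp
      · exact fun i _ hi => if_neg fun h => hi (hτ h.symm)
      · simp
    · rw [not_exists] at ht
      simp [ht, weight_zero]
  rw [RejectsWithProb, h1]
  exact hasSum_sum fun j _ => hasSum_ite_eq (τ j) _

end QCounterData

/-! ### The automaton and its single steps. -/

section Automaton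

open Core Coin Sum SquareState

open scoped Kronecker

variable (N : ℕ) [NeZero N]

/-- A permutation of the states that extends the partial transition function. -/
noncomputable def squarePerm (σ : TapeSym AB) (s : Fin 2) : Equiv.Perm (SquareState N) :=
  (exists_perm_extending (SquareState.next (N := N) σ s) (SquareState.prev σ s)
    fun _ _ => SquareState.prev_of_next).choose

variable {N} in
theorem squarePerm_of_next {σ : TapeSym AB} {s : Fin 2} {q q' : SquareState N}
    (h : SquareState.next σ s q = some q') : squarePerm N σ s q = q' :=
  (exists_perm_extending (SquareState.next (N := N) σ s) (SquareState.prev σ s)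
    fun _ _ => SquareState.prev_of_next).choose_spec q q' h

/-- The branching matrix: the uniform reflection on the branches at each of the coins. -/
noncomputable def branching : Matrix (SquareState N) (SquareState N) ℂ :=
  Matrix.fromBlocks 1 0 0 ((1 : Matrix Coin Coin ℂ) ⊗ₖ uniformReflection N)

/-- The transition amplitudes. -/
noncomputable def squareAmplitude (σ : TapeSym AB) (s : Fin 2) :
    Matrix (SquareState N) (SquareState N) ℂ :=
  (branching N).submatrix id (squarePerm N σ s)

/-- The accepting states. -/
def squareAcc : Set (SquareState N) := {q | ∃ g, g ≠ split ∧ q = inr (g, 0)}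

/-- The rejecting states. -/
def squareRej : Set (SquareState N) :=
  {q | q = inl fail ∨ ∃ g l, g ≠ split ∧ l ≠ 0 ∧ q = inr (g, l)}

/-- The data of the automaton for `{a ^ n b ^ (n ^ 2)}` with `N` branches. -/
noncomputable abbrev squareData : QCounterData AB :=
  directedData (squareAmplitude N) SquareState.count SquareState.move (inl start)
    (squareAcc N) (squareRej N)

variable {N}

theorem branching_mem_unitaryGroup (hN : 2 ≤ N) :
    branching N ∈ Matrix.unitaryGroup (SquareState N) ℂ := by
  have h : (1 : Matrix Coin Coin ℂ) ⊗ₖ uniformReflection N ∈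
      Matrix.unitaryGroup (Coin × Fin N) ℂ :=
    Matrix.kronecker_mem_unitary (one_mem _) (uniformReflection_mem_unitaryGroup hN)
  rw [Matrix.mem_unitaryGroup_iff, Matrix.star_eq_conjTranspose] at h ⊢
  rw [branching, Matrix.fromBlocks_conjTranspose, Matrix.fromBlocks_multiply]
  simp [h, Matrix.fromBlocks_one]

theorem squareAmplitude_mem_unitaryGroup (hN : 2 ≤ N) (σ : TapeSym AB) (s : Fin 2) :
    squareAmplitude N σ s ∈ Matrix.unitaryGroup (SquareState N) ℂ := by
  have h := branching_mem_unitaryGroup hN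
  rw [Matrix.mem_unitaryGroup_iff, Matrix.star_eq_conjTranspose] at h ⊢
  rw [squareAmplitude, Matrix.conjTranspose_submatrix, Matrix.submatrix_mul_equiv, h]
  simp

/-- The automaton for `{a ^ n b ^ (n ^ 2)}` with `N` branches. -/
noncomputable def squareAutomaton (hN : 2 ≤ N) : TwoQ1CA AB where
  toQCounterData := squareData N
  disjoint_acc_rej := by
    rw [Set.disjoint_left]
    rintro q ⟨g, hg, rfl⟩ (h | ⟨g', l, _, hl, h⟩)
    · cases h
    · simp only [inr.injEq, Prod.mk.injEq] at h
      exact hl h.2.symm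
  wellFormed := directedData_isWellFormed _ _ _ _ _ _ (squareAmplitude_mem_unitaryGroup hN)
  unitaryOn := directedData_isUnitaryOn _ _ _ _ _ _ (squareAmplitude_mem_unitaryGroup hN)

/-- Entering the state `q` from a configuration with counter `a` and head position `b`. -/
def enterState (x : List AB) (q : SquareState N) (a : ℤ) (b : TapePos x) : (squareData N).Config x :=
  (q, a + (SquareState.count q : ℤ), b + (((SquareState.move q).shift : ℤ) : TapePos x))

variable {x : List AB} {q : SquareState N} {a : ℤ} {b : TapePos x}

theorem squareData_evolve_single : (squareData N).evolve x (Finsupp.single (q, a, b) 1) =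
    ∑ q' : SquareState N, Finsupp.single (enterState x q' a b)
      (branching N q' (squarePerm N (tapeSymAt x b) (counterStatus a) q)) :=
  directedData_evolve_single _ _ _ _ _ _ x q a b

theorem evolve_of_next_inl {c : Core N}
    (h : SquareState.next (tapeSymAt x b) (counterStatus a) q = some (inl c)) :
    (squareData N).evolve x (Finsupp.single (q, a, b) 1) =
      Finsupp.single (enterState x (inl c) a b) 1 := by
  rw [squareData_evolve_single, squarePerm_of_next h, Fintype.sum_eq_single (inl c)]
  · simp [branching]
  · rintro (q' | q') hq'
    · have : q' ≠ c := fun h => hq' (congrArg inl h)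
      simp [branching, this]
    · simp [branching]

theorem evolve_of_next_inr {g : Coin} {i : Fin N}
    (h : SquareState.next (tapeSymAt x b) (counterStatus a) q = some (inr (g, i))) :
    (squareData N).evolve x (Finsupp.single (q, a, b) 1) =
      ∑ l : Fin N, Finsupp.single (enterState x (inr (g, l)) a b) (uniformReflection N l i) := by
  rw [squareData_evolve_single, squarePerm_of_next h, Fintype.sum_sum_type, Fintype.sum_prod_type,
    Finset.sum_eq_zero, zero_add, Fintype.sum_eq_single g]
  · simp [branching]
  · intro g' hg'
    simp [branching, hg']
  · intro q' _
    simp [branching]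

theorem step_of_next {c : Core N} (hc : c ≠ fail)
    (h : SquareState.next (tapeSymAt x b) (counterStatus a) q = some (inl c)) :
    (squareData N).Step x (q, a, b) (enterState x (inl c) a b) := by
  refine ⟨evolve_of_next_inl h, ?_, ?_⟩
  · rintro ⟨g, _, h⟩
    cases h
  · rintro (h | ⟨g, l, _, _, h⟩)
    · exact hc (inl.inj h)
    · cases h

end Automaton

/-! ### Reading the tape. -/

section Tape

variable {A : Type}

theorem tapeSymAt_natCast (x : List A) {k : ℕ} (hk : k < x.length + 2) :
    tapeSymAt x (k : TapePos x) = (tapeWord x)[k]'(by simp [tapeWord]; omega) := by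
  simp only [tapeSymAt, ZMod.val_natCast, Nat.mod_eq_of_lt hk]

theorem tapeSymAt_zero (x : List A) : tapeSymAt x ((0 : ℕ) : TapePos x) = .leftEnd := by
  rw [tapeSymAt_natCast x (by omega)]
  rfl

theorem tapeSymAt_succ (x : List A) {k : ℕ} (hk : k < x.length) :
    tapeSymAt x ((k + 1 : ℕ) : TapePos x) = .letter x[k] := by
  rw [tapeSymAt_natCast x (by omega)]
  simp [tapeWord, hk]

theorem tapeSymAt_length_succ (x : List A) :
    tapeSymAt x ((x.length + 1 : ℕ) : TapePos x) = .rightEnd := by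
  rw [tapeSymAt_natCast x (by omega)]
  simp [tapeWord]

theorem counterStatus_zero : counterStatus ((0 : ℕ) : ℤ) = 0 := rfl

theorem counterStatus_pos {v : ℕ} (hv : 0 < v) : counterStatus (v : ℤ) = 1 := by
  rw [counterStatus, if_neg (by exact_mod_cast hv.ne')]

/-- The tape holds the word `a ^ m b ^ n`. -/
structure IsBlockTape (x : List AB) (m n : ℕ) : Prop where
  leftEnd : tapeSymAt x ((0 : ℕ) : TapePos x) = .leftEnd
  lettersA : ∀ k, 0 < k → k ≤ m → tapeSymAt x (k : TapePos x) = .letter .a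
  lettersB : ∀ k, m < k → k ≤ m + n → tapeSymAt x (k : TapePos x) = .letter .b
  rightEnd : tapeSymAt x ((m + n + 1 : ℕ) : TapePos x) = .rightEnd

theorem isBlockTape_wordAB (m n : ℕ) : IsBlockTape (wordAB m n) m n := by
  have hl : (wordAB m n).length = m + n := by simp [wordAB]
  refine ⟨tapeSymAt_zero _, ?_, ?_, ?_⟩
  · intro k h0 h1
    obtain ⟨k, rfl⟩ : ∃ k', k = k' + 1 := ⟨k - 1, by omega⟩
    rw [tapeSymAt_succ _ (by omega)]
    simp [wordAB, show k < m by omega]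
  · intro k h0 h1
    obtain ⟨k, rfl⟩ : ∃ k', k = k' + 1 := ⟨k - 1, by omega⟩
    rw [tapeSymAt_succ _ (by omega)]
    simp [wordAB, List.getElem_append, show ¬k < m by omega]
  · have h := tapeSymAt_length_succ (wordAB m n)
    have h' : ((m + n + 1 : ℕ) : TapePos (wordAB m n)) = ((wordAB m n).length + 1 : ℕ) :=
      congrArg (fun l : ℕ => ((l + 1 : ℕ) : TapePos (wordAB m n))) hl.symm
    rw [h', h]

end Tape

/-! ### Runs of the gauge computation. -/

namespace Gauge

/-- A step of the gauge computation. -/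
def Step (x : List AB) (κ κ' : Gauge × ℤ × TapePos x) : Prop :=
  next (tapeSymAt x κ.2.2) (counterStatus κ.2.1) κ.1 = some κ'.1 ∧
    κ'.2.1 = κ.2.1 + (κ'.1.count : ℤ) ∧
      κ'.2.2 = κ.2.2 + ((κ'.1.move.shift : ℤ) : TapePos x)

/-- The configuration with state `p`, counter value `v` and head position `k`. -/
abbrev conf (x : List AB) (p : Gauge) (v k : ℕ) : Gauge × ℤ × TapePos x := (p, v, k)

variable {x : List AB} {m n : ℕ}

theorem step_conf {p p' : Gauge} {v k v' k' : ℕ} {σ : TapeSym AB} {s : Fin 2}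
    (hσ : tapeSymAt x (k : TapePos x) = σ) (hs : counterStatus (v : ℤ) = s)
    (h : next σ s p = some p') (hv : (v' : ℤ) = v + (p'.count : ℤ))
    (hk : (k' : ℤ) = k + p'.move.shift) : Step x (conf x p v k) (conf x p' v' k') := by
  refine ⟨by rw [hσ, hs, h], hv, ?_⟩
  have := congrArg (Int.cast : ℤ → TapePos x) hk
  push_cast at this
  exact this

theorem val_natCast_mod (v : ℕ) {d : ℕ} (hd : d ∣ 12) : (v : ZMod 12).val % d = v % d := by
  rw [ZMod.val_natCast, Nat.mod_mod_of_dvd _ hd]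

theorem _root_.Ratio.div_dvd (μ : Ratio) : μ.div ∣ 12 := by cases μ <;> decide

theorem _root_.Ratio.mul_dvd (μ : Ratio) : μ.mul ∣ 12 := by cases μ <;> decide

theorem _root_.Ratio.div_pos (μ : Ratio) : 0 < μ.div := by cases μ <;> decide

theorem _root_.Ratio.mul_pos (μ : Ratio) : 0 < μ.mul := by cases μ <;> decide

theorem move_out (μ : Ratio) (v : ℕ) :
    (out μ v).move = if (v + 1) % μ.div = 0 then .right else .stay := by
  rw [move, ← val_natCast_mod (v + 1) μ.div_dvd]
  push_cast
  rfl

theorem move_into (μ : Ratio) (v : ℕ) :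
    (into μ v).move = if v % μ.mul = 0 then .left else .stay := by
  rw [move, val_natCast_mod v μ.mul_dvd]

/-- The quantity `k + v / μ.div` is invariant: the head moves right exactly when a decrement lowers
the quotient. -/
theorem steps_out (hx : IsBlockTape x m n) (μ : Ratio) {t : ℕ} (ht : t ≤ n) (v : ℕ) :
    ∀ k, k + v / μ.div = m + t → v < μ.div * t →
      IterRel (Step x) v (conf x (out μ v) v k) (conf x (out μ 0) 0 (m + t)) := by
  induction v with
  | zero =>
    intro k hk _
    simp only [Nat.zero_div, add_zero] at hk
    subst hk
    exact IterRel.refl _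
  | succ v ih =>
    intro k hk hv
    have h1 : (v + 1) / μ.div < t := Nat.div_lt_of_lt_mul hv
    have h2 := Nat.zero_le ((v + 1) / μ.div)
    have hsd := Nat.succ_div (a := v) (b := μ.div)
    have hstep : ∀ k' : ℕ, (k' : ℤ) = k + (out μ v).move.shift →
        Step x (conf x (out μ ((v + 1 : ℕ) : ZMod 12)) (v + 1) k) (conf x (out μ v) v k') := by
      intro k' hk'
      refine step_conf (hx.lettersB k (by omega) (by omega)) (counterStatus_pos v.succ_pos) ?_ ?_ hk'
      · simp [next]
      · simp [count]
    rw [move_out] at hstep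
    by_cases hd : μ.div ∣ v + 1
    · rw [if_pos (Nat.mod_eq_zero_of_dvd hd)] at hstep
      rw [if_pos hd] at hsd
      exact IterRel.head (hstep (k + 1) (by simp [HeadMove.shift])) (ih (k + 1) (by omega) (by omega))
    · rw [if_neg (fun h => hd (Nat.dvd_of_mod_eq_zero h))] at hstep
      rw [if_neg hd] at hsd
      exact IterRel.head (hstep k (by simp [HeadMove.shift])) (ih k (by omega) (by omega))

theorem steps_into (hx : IsBlockTape x m n) (μ : Ratio) {t : ℕ} (ht0 : 0 < t) (ht : t ≤ n) (v : ℕ) :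
    ∀ k, k + (v + 1) / μ.mul = m + t → v + 1 ≤ μ.mul * t →
      IterRel (Step x) (v + 1) (conf x (out μ 0) 0 (m + t))
        (conf x (into μ ((v + 1 : ℕ) : ZMod 12)) (v + 1) k) := by
  have hmove : ∀ v k k' : ℕ, k' + (v + 1) / μ.mul = m + t → k + v / μ.mul = m + t →
      (k' : ℤ) = k + (into μ ((v + 1 : ℕ) : ZMod 12)).move.shift := by
    intro v k k' hk' hk
    have hsd := Nat.succ_div (a := v) (b := μ.mul)
    rw [move_into]
    by_cases hd : μ.mul ∣ v + 1
    · rw [if_pos hd] at hsd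
      rw [if_pos (Nat.mod_eq_zero_of_dvd hd)]
      simp only [HeadMove.shift]
      omega
    · rw [if_neg hd] at hsd
      rw [if_neg (fun h => hd (Nat.dvd_of_mod_eq_zero h))]
      simp only [HeadMove.shift]
      omega
  induction v with
  | zero =>
    intro k hk _
    refine IterRel.single (step_conf (hx.lettersB (m + t) (by omega) (by omega)) counterStatus_zero
      ?_ ?_ (hmove 0 (m + t) k hk (by simp)))
    · simp [next]
    · simp [count]
  | succ v ih =>
    intro k hk hv
    have h1 : (v + 1) / μ.mul < t := Nat.div_lt_of_lt_mul (by omega)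
    have h2 := Nat.zero_le ((v + 1) / μ.mul)
    refine IterRel.tail (ih (m + t - (v + 1) / μ.mul) (by omega) (by omega))
      (step_conf (hx.lettersB (m + t - (v + 1) / μ.mul) (by omega) (by omega))
        (counterStatus_pos v.succ_pos) ?_ ?_
        (hmove (v + 1) _ k hk (by omega)))
    · simp [next]
    · simp [count]

/-- The head position stores the quotient: counting `μ.div * t` down to zero brings the head `t`
squares into the `b`-block, and the way back counts `μ.mul` per square. The first of the decrements
occurs on entering the round, whence `v + 1`. -/
theorem steps_round (hx : IsBlockTape x m n) (μ : Ratio) {t v : ℕ} (ht0 : 0 < t) (ht : t ≤ n)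
    (hv : v + 1 = μ.div * t) :
    IterRel (Step x) (v + μ.mul * t) (conf x (out μ v) v (m + 1))
      (conf x (into μ ((μ.mul * t : ℕ) : ZMod 12)) (μ.mul * t) m) := by
  have h0 := μ.mul_pos
  have h1 := Nat.mul_pos h0 ht0
  have hdiv : v / μ.div = t - 1 := by
    have := Nat.succ_div (a := v) (b := μ.div)
    rw [hv, if_pos (Dvd.intro _ rfl), Nat.mul_div_cancel_left _ μ.div_pos] at this
    omega
  have h := steps_into hx μ ht0 ht (μ.mul * t - 1) m
  rw [Nat.sub_add_cancel h1, Nat.mul_div_cancel_left _ h0] at h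
  exact (steps_out hx μ ht v (m + 1) (by omega) (by omega)).trans (h rfl le_rfl)

theorem four_pow_succ_cast (i : ℕ) : ((4 ^ (i + 1) : ℕ) : ZMod 12) = 4 := by
  induction i with
  | zero => decide
  | succ i ih =>
    rw [pow_succ, Nat.cast_mul, ih]
    decide

theorem natCast_of_twelve_dvd {v : ℕ} (h : 12 ∣ v) : (v : ZMod 12) = 0 :=
  (ZMod.natCast_eq_zero_iff v 12).2 h

theorem three_pow_succ_cast (i : ℕ) :
    ((3 ^ (i + 1) : ℕ) : ZMod 12) = 3 ∨ ((3 ^ (i + 1) : ℕ) : ZMod 12) = 9 := by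
  induction i with
  | zero => decide
  | succ i ih =>
    rw [pow_succ, Nat.cast_mul]
    rcases ih with ih | ih <;> rw [ih] <;> decide

theorem two_pow_succ_cast (i : ℕ) : ((2 ^ (i + 1) : ℕ) : ZMod 12) = 2 ∨
    ((2 ^ (i + 1) : ℕ) : ZMod 12) = 4 ∨ ((2 ^ (i + 1) : ℕ) : ZMod 12) = 8 := by
  induction i with
  | zero => decide
  | succ i ih =>
    rw [pow_succ, Nat.cast_mul]
    rcases ih with ih | ih | ih <;> rw [ih] <;> decide

theorem natCast_of_six_dvd {v : ℕ} (h : 6 ∣ v) : (v : ZMod 12) = 0 ∨ (v : ZMod 12) = 6 := by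
  obtain ⟨w, rfl⟩ := h
  rw [Nat.cast_mul]
  generalize (w : ZMod 12) = r
  revert r
  decide

theorem natCast_pred {v : ℕ} (h : 0 < v) : ((v - 1 : ℕ) : ZMod 12) = v - 1 := by
  rw [Nat.cast_sub h, Nat.cast_one]

/-- The counter is quadrupled as long as its value fits into the `b`-block; each quadrupling of `4 ^
i` costs `5 * 4 ^ i` steps. -/
theorem steps_up (hx : IsBlockTape x m n) (hm : 0 < m) (i : ℕ) (hi : ∀ i', i' < i → 4 ^ i' ≤ n) :
    ∃ T, T ≤ 2 * 4 ^ i ∧ IterRel (Step x) T (conf x (out .up 0) 0 (m + 1))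
      (conf x (out .up ((4 ^ i - 1 : ℕ) : ZMod 12)) (4 ^ i - 1) (m + 1)) := by
  induction i with
  | zero => exact ⟨0, by simp, by simpa using IterRel.refl _⟩
  | succ i ih =>
    obtain ⟨T, hT, h⟩ := ih fun i' hi' => hi i' (by omega)
    have hp : 0 < 4 ^ i := by positivity
    have h1 := steps_round hx .up hp (hi i (by omega)) (v := 4 ^ i - 1)
      (by simp only [Ratio.div]; omega)
    have hc : Ratio.up.mul * 4 ^ i = 4 ^ (i + 1) := by rw [pow_succ, mul_comm]; rfl
    rw [hc] at h1
    have hp' : 0 < 4 ^ (i + 1) := by positivity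
    have h2 : Step x (conf x (into .up ((4 ^ (i + 1) : ℕ) : ZMod 12)) (4 ^ (i + 1)) m)
        (conf x (out .up ((4 ^ (i + 1) - 1 : ℕ) : ZMod 12)) (4 ^ (i + 1) - 1) (m + 1)) := by
      rw [natCast_pred hp', four_pow_succ_cast]
      refine step_conf (hx.lettersA m hm le_rfl) (counterStatus_pos hp') (p' := out .up 3) ?_ ?_ ?_
      · simp [next]
      · simp [count, Nat.cast_sub hp']
        ring
      · simp [move, Ratio.div, Nat.mod_one, HeadMove.shift]
    refine ⟨_, ?_, (h.trans h1).tail h2⟩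
    rw [pow_succ]
    omega

/-- A value `p > n` does not fit: the head meets the right end-marker, and `bounce` adds back one
unit per square, so that `p` is restored on the last `a`. -/
theorem steps_turn (hx : IsBlockTape x m n) (hm : 0 < m) {p : ℕ} (hp : n < p)
    (hr : (p : ZMod 12) = 4) :
    IterRel (Step x) (2 * n + 2) (conf x (out .up ((p - 1 : ℕ) : ZMod 12)) (p - 1) (m + 1))
      (conf x (out .mid ((p - 1 : ℕ) : ZMod 12)) (p - 1) (m + 1)) := by
  have h1 : ∀ d ≤ n, IterRel (Step x) d
      (conf x (out .up ((p - 1 : ℕ) : ZMod 12)) (p - 1) (m + 1))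
      (conf x (out .up ((p - 1 - d : ℕ) : ZMod 12)) (p - 1 - d) (m + 1 + d)) := by
    intro d hd
    induction d with
    | zero => exact IterRel.refl _
    | succ d ih =>
      refine (ih (by omega)).tail (step_conf (hx.lettersB _ (by omega) (by omega))
        (counterStatus_pos (by omega)) ?_ ?_ ?_)
      · rw [show p - 1 - d = (p - 1 - (d + 1)) + 1 by omega]
        simp [next]
      · simp [count]
        omega
      · rw [move_out]
        simp [Ratio.div, Nat.mod_one, HeadMove.shift]
        ring
  have h2 : ∀ d ≤ n, IterRel (Step x) (n + 1 + d)
      (conf x (out .up ((p - 1 : ℕ) : ZMod 12)) (p - 1) (m + 1))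
      (conf x (bounce ((p - n + d : ℕ) : ZMod 12)) (p - n + d) (m + n - d)) := by
    intro d hd
    induction d with
    | zero =>
      refine (h1 n le_rfl).tail (step_conf (σ := .rightEnd) ?_ rfl ?_ ?_ ?_)
      · rw [show m + 1 + n = m + n + 1 by ring, hx.rightEnd]
      · rw [show p - n + 0 = p - 1 - n + 1 by omega]
        simp [next]
      · simp [count]
        omega
      · simp [move, HeadMove.shift]
        ring
    | succ d ih =>
      refine (ih (by omega)).tail (step_conf (hx.lettersB _ (by omega) (by omega))
        (counterStatus_pos (by omega)) ?_ ?_ ?_)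
      · rw [← add_assoc]
        simp [next]
      · simp [count]
        ring
      · simp only [move, HeadMove.shift]
        omega
  refine ((h2 n le_rfl).tail (step_conf (hx.lettersA _ (by omega) (by omega))
    (counterStatus_pos (by omega)) ?_ ?_ ?_)).of_eq (by ring) rfl
  · rw [Nat.sub_add_cancel hp.le, natCast_pred (by omega), hr]
    simp [next]
    decide
  · simp [count]
    omega
  · rw [natCast_pred (by omega), hr]
    have : (out .mid (4 - 1)).move = .right := by decide
    rw [this]
    simp only [HeadMove.shift]
    omega

/-- Each round trades a factor `4` for a factor `3` until none is left. A round that starts from `P`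
takes at most `7 / 4 * P` steps, and the ratio `3 / 4` sums these to at most `7 * P`. -/
theorem steps_mid (hx : IsBlockTape x m n) (hm : 0 < m) (j : ℕ) : ∀ i, 3 ^ i * 4 ^ j ≤ n →
    ∃ T, T ≤ 7 * (3 ^ i * 4 ^ (j + 1)) ∧ IterRel (Step x) T
      (conf x (out .mid ((3 ^ i * 4 ^ (j + 1) - 1 : ℕ) : ZMod 12)) (3 ^ i * 4 ^ (j + 1) - 1) (m + 1))
      (conf x (into .mid ((3 ^ (i + j + 1) : ℕ) : ZMod 12)) (3 ^ (i + j + 1)) m) := by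
  have key : ∀ i j, 3 ^ i * 4 ^ j ≤ n → IterRel (Step x)
      (3 ^ i * 4 ^ (j + 1) - 1 + 3 ^ (i + 1) * 4 ^ j)
      (conf x (out .mid ((3 ^ i * 4 ^ (j + 1) - 1 : ℕ) : ZMod 12)) (3 ^ i * 4 ^ (j + 1) - 1) (m + 1))
      (conf x (into .mid ((3 ^ (i + 1) * 4 ^ j : ℕ) : ZMod 12)) (3 ^ (i + 1) * 4 ^ j) m) := by
    intro i j h
    have hp : 0 < 3 ^ i * 4 ^ j := by positivity
    have h1 := steps_round hx .mid hp h (v := 3 ^ i * 4 ^ (j + 1) - 1)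
      (by
        rw [show 3 ^ i * 4 ^ (j + 1) = 4 * (3 ^ i * 4 ^ j) by ring]
        simp only [Ratio.div]
        omega)
    have hc : Ratio.mid.mul * (3 ^ i * 4 ^ j) = 3 ^ (i + 1) * 4 ^ j := by
      simp only [Ratio.mul]; ring
    rwa [hc] at h1
  induction j with
  | zero =>
    intro i h
    refine ⟨_, ?_, (key i 0 h).of_eq rfl (by simp)⟩
    rw [pow_succ]
    omega
  | succ j ih =>
    intro i h
    have hle : 3 ^ (i + 1) * 4 ^ j ≤ n := by
      refine le_trans ?_ h
      rw [pow_succ, pow_succ]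
      nlinarith [Nat.zero_le (3 ^ i * 4 ^ j)]
    obtain ⟨T, hT, h1⟩ := ih (i + 1) hle
    have hp : 0 < 3 ^ (i + 1) * 4 ^ (j + 1) := by positivity
    have hr : ((3 ^ (i + 1) * 4 ^ (j + 1) : ℕ) : ZMod 12) = 0 :=
      natCast_of_twelve_dvd ⟨3 ^ i * 4 ^ j, by ring⟩
    have h2 : Step x
        (conf x (into .mid ((3 ^ (i + 1) * 4 ^ (j + 1) : ℕ) : ZMod 12)) (3 ^ (i + 1) * 4 ^ (j + 1)) m)
        (conf x (out .mid ((3 ^ (i + 1) * 4 ^ (j + 1) - 1 : ℕ) : ZMod 12))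
          (3 ^ (i + 1) * 4 ^ (j + 1) - 1) (m + 1)) := by
      rw [natCast_pred hp, hr]
      refine step_conf (hx.lettersA m hm le_rfl) (counterStatus_pos hp) ?_ ?_ ?_
      · simp [next]
        decide
      · simp only [count]
        rw [Nat.cast_sub hp]
        simp
        ring
      · have : (out .mid (0 - 1)).move = .right := by decide
        rw [this]
        simp [HeadMove.shift]
    refine ⟨_, ?_, (((key i (j + 1) h).tail h2).trans h1).of_eq rfl
      (by rw [show i + (j + 1) + 1 = i + 1 + j + 1 by ring])⟩
    have e1 : 3 ^ i * 4 ^ (j + 1 + 1) = 16 * (3 ^ i * 4 ^ j) := by ring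
    have e2 : 3 ^ (i + 1) * 4 ^ (j + 1) = 12 * (3 ^ i * 4 ^ j) := by ring
    omega

/-- As in `steps_mid` with factors `3` traded for `2`: a round costs at most `5 / 3 * P`, and the
ratio `2 / 3` gives `5 * P`. -/
theorem steps_low (hx : IsBlockTape x m n) (hm : 0 < m) (j : ℕ) : ∀ i, 2 ^ i * 3 ^ j ≤ n →
    ∃ T, T ≤ 5 * (2 ^ i * 3 ^ (j + 1)) ∧ IterRel (Step x) T
      (conf x (out .low ((2 ^ i * 3 ^ (j + 1) - 1 : ℕ) : ZMod 12)) (2 ^ i * 3 ^ (j + 1) - 1) (m + 1))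
      (conf x (into .low ((2 ^ (i + j + 1) : ℕ) : ZMod 12)) (2 ^ (i + j + 1)) m) := by
  have key : ∀ i j, 2 ^ i * 3 ^ j ≤ n → IterRel (Step x)
      (2 ^ i * 3 ^ (j + 1) - 1 + 2 ^ (i + 1) * 3 ^ j)
      (conf x (out .low ((2 ^ i * 3 ^ (j + 1) - 1 : ℕ) : ZMod 12)) (2 ^ i * 3 ^ (j + 1) - 1) (m + 1))
      (conf x (into .low ((2 ^ (i + 1) * 3 ^ j : ℕ) : ZMod 12)) (2 ^ (i + 1) * 3 ^ j) m) := by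
    intro i j h
    have hp : 0 < 2 ^ i * 3 ^ j := by positivity
    have h1 := steps_round hx .low hp h (v := 2 ^ i * 3 ^ (j + 1) - 1)
      (by
        rw [show 2 ^ i * 3 ^ (j + 1) = 3 * (2 ^ i * 3 ^ j) by ring]
        simp only [Ratio.div]
        omega)
    have hc : Ratio.low.mul * (2 ^ i * 3 ^ j) = 2 ^ (i + 1) * 3 ^ j := by
      simp only [Ratio.mul]; ring
    rwa [hc] at h1
  induction j with
  | zero =>
    intro i h
    refine ⟨_, ?_, (key i 0 h).of_eq rfl (by simp)⟩
    rw [pow_succ]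
    omega
  | succ j ih =>
    intro i h
    have hle : 2 ^ (i + 1) * 3 ^ j ≤ n := by
      refine le_trans ?_ h
      rw [pow_succ, pow_succ]
      nlinarith [Nat.zero_le (2 ^ i * 3 ^ j)]
    obtain ⟨T, hT, h1⟩ := ih (i + 1) hle
    have hp : 0 < 2 ^ (i + 1) * 3 ^ (j + 1) := by positivity
    have hr := natCast_of_six_dvd (v := 2 ^ (i + 1) * 3 ^ (j + 1)) ⟨2 ^ i * 3 ^ j, by ring⟩
    have h2 : Step x
        (conf x (into .low ((2 ^ (i + 1) * 3 ^ (j + 1) : ℕ) : ZMod 12)) (2 ^ (i + 1) * 3 ^ (j + 1)) m)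
        (conf x (out .low ((2 ^ (i + 1) * 3 ^ (j + 1) - 1 : ℕ) : ZMod 12))
          (2 ^ (i + 1) * 3 ^ (j + 1) - 1) (m + 1)) := by
      rw [natCast_pred hp]
      refine step_conf (hx.lettersA m hm le_rfl) (counterStatus_pos hp) ?_ ?_ ?_
      · rw [next, if_pos hr]
      · simp only [count]
        rw [Nat.cast_sub hp]
        simp
        ring
      · have : ∀ r : ZMod 12, r = 0 ∨ r = 6 → (out .low (r - 1)).move = .right := by decide
        rw [this _ hr]
        simp [HeadMove.shift]
    refine ⟨_, ?_, (((key i (j + 1) h).tail h2).trans h1).of_eq rfl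
      (by rw [show i + (j + 1) + 1 = i + 1 + j + 1 by ring])⟩
    have e1 : 2 ^ i * 3 ^ (j + 1 + 1) = 9 * (2 ^ i * 3 ^ j) := by ring
    have e2 : 2 ^ (i + 1) * 3 ^ (j + 1) = 6 * (2 ^ i * 3 ^ j) := by ring
    omega

end Gauge

namespace Gauge

variable {x : List AB} {m n : ℕ}

theorem steps_enter (hx : IsBlockTape x m n) (hm : 0 < m) :
    IterRel (Step x) (n + 1) (conf x enter 1 (m + n)) (conf x (out .up 0) 0 (m + 1)) := by
  have h : ∀ d ≤ n, IterRel (Step x) d (conf x enter 1 (m + n)) (conf x enter 1 (m + n - d)) := by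
    intro d hd
    induction d with
    | zero => exact IterRel.refl _
    | succ d ih =>
      refine (ih (by omega)).tail (step_conf (hx.lettersB _ (by omega) (by omega))
        (counterStatus_pos one_pos) rfl rfl ?_)
      simp only [move, HeadMove.shift]
      omega
  refine (h n le_rfl).tail (step_conf (hx.lettersA _ (by omega) (by omega))
    (counterStatus_pos one_pos) rfl rfl ?_)
  have : (out .up 0).move = .right := by decide
  rw [this]
  simp only [HeadMove.shift]
  omega

/-- The gauge computation brings `2 ^ (k + 1)` to the counter, where `4 ^ k ≤ n < 4 ^ (k + 1)`. -/
theorem steps_gauge (hx : IsBlockTape x m n) (hm : 0 < m) (hn : 0 < n) :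
    ∃ k T : ℕ, ∃ r : ZMod 12, 4 ^ k ≤ n ∧ n < 4 ^ (k + 1) ∧ T ≤ 59 * n + 6 ∧
      IterRel (Step x) T (conf x enter 1 (m + n)) (conf x (compare r) (2 ^ (k + 1)) m) := by
  obtain ⟨k, hk1, hk2⟩ : ∃ k, 4 ^ k ≤ n ∧ n < 4 ^ (k + 1) :=
    ⟨Nat.log 4 n, Nat.pow_log_le_self 4 hn.ne', Nat.lt_pow_succ_log_self (by norm_num) n⟩
  obtain ⟨T1, hT1, h1⟩ := steps_up hx hm (k + 1) fun i hi =>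
    (Nat.pow_le_pow_right (by norm_num) (by omega)).trans hk1
  have h2 := steps_turn hx hm hk2 (four_pow_succ_cast k)
  obtain ⟨T3, hT3, h3⟩ := steps_mid hx hm k 0 (by simpa using hk1)
  have h34 : 3 ^ k ≤ 4 ^ k := Nat.pow_le_pow_left (by norm_num) k
  obtain ⟨T5, hT5, h5⟩ := steps_low hx hm k 0 (by simpa using h34.trans hk1)
  simp only [pow_zero, one_mul, zero_add] at h3 h5 hT3 hT5
  have hp3 : 0 < 3 ^ (k + 1) := by positivity
  have hp2 : 0 < 2 ^ (k + 1) := by positivity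
  have h4 : Step x (conf x (into .mid ((3 ^ (k + 1) : ℕ) : ZMod 12)) (3 ^ (k + 1)) m)
      (conf x (out .low ((3 ^ (k + 1) - 1 : ℕ) : ZMod 12)) (3 ^ (k + 1) - 1) (m + 1)) := by
    rw [natCast_pred hp3]
    have hr := three_pow_succ_cast k
    generalize ((3 ^ (k + 1) : ℕ) : ZMod 12) = r at hr
    refine step_conf (hx.lettersA m hm le_rfl) (counterStatus_pos hp3) ?_ ?_ ?_
    · have : r ≠ 0 := by revert hr; revert r; decide
      rw [next, if_neg this, if_pos hr]
    · simp only [count]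
      rw [Nat.cast_sub hp3]
      simp
      ring
    · have : ∀ r : ZMod 12, r = 3 ∨ r = 9 → (out .low (r - 1)).move = .right := by decide
      rw [this _ hr]
      simp [HeadMove.shift]
  have hr := two_pow_succ_cast k
  have h6 : Step x (conf x (into .low ((2 ^ (k + 1) : ℕ) : ZMod 12)) (2 ^ (k + 1)) m)
      (conf x (lift ((2 ^ (k + 1) : ℕ) : ZMod 12)) (2 ^ (k + 1) + 1) (m + 1)) := by
    generalize ((2 ^ (k + 1) : ℕ) : ZMod 12) = r at hr
    refine step_conf (hx.lettersA m hm le_rfl) (counterStatus_pos hp2) ?_ ?_ ?_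
    · have : ¬(r = 0 ∨ r = 6) := by revert hr; revert r; decide
      rw [next, if_neg this, if_pos hr]
    · simp [count]
    · simp [move, HeadMove.shift]
  have h7 : Step x (conf x (lift ((2 ^ (k + 1) : ℕ) : ZMod 12)) (2 ^ (k + 1) + 1) (m + 1))
      (conf x (compare ((2 ^ (k + 1) : ℕ) : ZMod 12)) (2 ^ (k + 1)) m) := by
    refine step_conf (hx.lettersB _ (by omega) (by omega)) (counterStatus_pos (by omega)) rfl ?_ ?_
    · simp [count]
    · simp [move, HeadMove.shift]
  -- With `4 ^ (k + 1) ≤ 4 * n`, the phases contribute `n + 8n + 2n + 28n + 20n = 59n`, and the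
  -- single steps contribute `6`.
  refine ⟨k, _, _, hk1, hk2, ?_, ((((((((steps_enter hx hm).trans h1).trans h2).trans h3).tail
    h4).trans h5).tail h6).tail h7)⟩
  have h34' : 3 ^ (k + 1) ≤ 4 ^ (k + 1) := Nat.pow_le_pow_left (by norm_num) _
  have : 4 ^ (k + 1) = 4 * 4 ^ k := by ring
  omega

theorem steps_compare (hx : IsBlockTape x m n) (r : ZMod 12) (p d : ℕ) (hp : d ≤ p) (hm : d ≤ m) :
    IterRel (Step x) d (conf x (compare r) p m) (conf x (compare r) (p - d) (m - d)) := by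
  induction d with
  | zero => exact IterRel.refl _
  | succ d ih =>
    refine (ih (by omega) (by omega)).tail (step_conf (hx.lettersA _ (by omega) (by omega))
      (counterStatus_pos (by omega)) rfl ?_ ?_)
    · simp [count]
      omega
    · simp only [move, HeadMove.shift]
      omega

end Gauge

/-! ### Runs of the whole automaton up to the final coin. -/

section Runs

open Core Coin Sum

variable {N : ℕ} [NeZero N] {x : List AB} {m n : ℕ}

/-- The configuration with state `q`, counter value `v` and head position `k`. -/
abbrev natConf (N : ℕ) [NeZero N] (x : List AB) (q : SquareState N) (v k : ℕ) :
    (squareData N).Config x := (q, (v : ℤ), (k : TapePos x))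

theorem enterState_eq_natConf {q : SquareState N} {v k v' k' : ℕ}
    (hv : (v' : ℤ) = v + (SquareState.count q : ℤ))
    (hk : (k' : ℤ) = k + (SquareState.move q).shift) :
    enterState x q (v : ℤ) (k : TapePos x) = natConf N x q v' k' := by
  have := congrArg (Int.cast : ℤ → TapePos x) hk
  push_cast at this
  rw [enterState, natConf, hv, this]

theorem step_natConf {q : SquareState N} {c : Core N} {v k v' k' : ℕ} {σ : TapeSym AB} {s : Fin 2}
    (hc : c ≠ fail) (hσ : tapeSymAt x (k : TapePos x) = σ) (hs : counterStatus (v : ℤ) = s)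
    (h : SquareState.next σ s q = some (inl c))
    (hv : (v' : ℤ) = v + (SquareState.count (inl c : SquareState N) : ℤ))
    (hk : (k' : ℤ) = k + (SquareState.move (inl c : SquareState N)).shift) :
    (squareData N).Step x (natConf N x q v k) (natConf N x (inl c) v' k') := by
  rw [← enterState_eq_natConf hv hk]
  exact step_of_next hc (by rw [hσ, hs, h])

/-- The configuration of the automaton that carries a gauge configuration. -/
def fwdConf (N : ℕ) [NeZero N] (x : List AB) (κ : Gauge × ℤ × TapePos x) :
    (squareData N).Config x := (inl (fwd κ.1), κ.2)

/-- The configuration of the automaton that carries a gauge configuration while the gauge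
computation is undone: the counter and the head are where they were before the last step. -/
def bwdConf (N : ℕ) [NeZero N] (x : List AB) (κ : Gauge × ℤ × TapePos x) :
    (squareData N).Config x :=
  (inl (bwd κ.1), κ.2.1 - (κ.1.count : ℤ), κ.2.2 - ((κ.1.move.shift : ℤ) : TapePos x))

theorem next_fwd {σ : TapeSym AB} {s : Fin 2} {p p' : Gauge} (h : Gauge.next σ s p = some p') :
    SquareState.next (N := N) σ s (inl (fwd p)) = some (inl (fwd p')) := by
  have hs : ∀ s : Fin 2, s = 0 ∨ s = 1 := by decide
  rcases σ with _ | _ | ⟨_ | _⟩ <;> (obtain rfl | rfl := hs s)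
  case leftEnd.inl => simp [Gauge.next] at h
  case leftEnd.inr => simp [Gauge.next] at h
  case letter.a.inl => simp [Gauge.next] at h
  all_goals simp [SquareState.next, h]

theorem next_bwd {σ : TapeSym AB} {s : Fin 2} {p p' : Gauge} (h : Gauge.next σ s p = some p') :
    SquareState.next (N := N) σ s (inl (bwd p')) = some (inl (bwd p)) := by
  have hs : ∀ s : Fin 2, s = 0 ∨ s = 1 := by decide
  rw [Gauge.next_eq_some_iff] at h
  rcases σ with _ | _ | ⟨_ | _⟩ <;> (obtain rfl | rfl := hs s)
  case leftEnd.inl => simp [Gauge.prev] at h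
  case leftEnd.inr => simp [Gauge.prev] at h
  case letter.a.inl => simp [Gauge.prev] at h
  case rightEnd.inr =>
    cases p' with
    | enter => simp [Gauge.prev] at h
    | _ => simp [SquareState.next, h]
  all_goals simp [SquareState.next, h]

theorem step_fwdConf {κ κ' : Gauge × ℤ × TapePos x} (h : Gauge.Step x κ κ') :
    (squareData N).Step x (fwdConf N x κ) (fwdConf N x κ') := by
  obtain ⟨h1, h2, h3⟩ := h
  have h4 : fwdConf N x κ' = enterState x (inl (fwd κ'.1)) κ.2.1 κ.2.2 :=
    Prod.ext rfl (Prod.ext h2 h3)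
  rw [h4]
  exact step_of_next (by simp) (next_fwd h1)

/-- By the shift in `bwdConf`, the reversed step reads the same symbol and counter status as the
forward step did, so `Gauge.prev` inverts it. -/
theorem step_bwdConf {κ κ' : Gauge × ℤ × TapePos x} (h : Gauge.Step x κ κ') :
    (squareData N).Step x (bwdConf N x κ') (bwdConf N x κ) := by
  obtain ⟨h1, h2, h3⟩ := h
  have h4 : bwdConf N x κ' = (inl (bwd κ'.1), κ.2.1, κ.2.2) := by
    rw [bwdConf, h2, h3, add_sub_cancel_right, add_sub_cancel_right]
  have h5 : bwdConf N x κ = enterState x (inl (bwd κ.1)) κ.2.1 κ.2.2 := by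
    simp only [bwdConf, enterState, SquareState.count, SquareState.move, HeadMove.shift_reverse,
      SignType.coe_neg, sub_eq_add_neg, Int.cast_neg]
  rw [h4, h5]
  exact step_of_next (by simp) (next_bwd h1)

/-- After a gauge computation that shows that the first block is short, the automaton comes back
to the right end-marker. -/
theorem steps_pass (hx : IsBlockTape x m n) {T v : ℕ} {r : ZMod 12} (hv : 0 < v)
    (h : IterRel (Gauge.Step x) T (Gauge.conf x .enter 1 (m + n))
      (Gauge.conf x (.compare r) v 0)) :
    IterRel ((squareData N).Step x) (2 * T + 1) (natConf N x (inl (fwd .enter)) 1 (m + n))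
      (natConf N x (inl (bwd .enter)) 1 (m + n + 1)) := by
  have h1 := h.map (f := fwdConf N x) fun _ _ => step_fwdConf
  have h2 := h.map_reverse (f := bwdConf N x) fun _ _ => step_bwdConf
  -- The turning point: with a positive counter on the left end-marker, entering the backward state
  -- takes back the counter change and the head move of the last forward step.
  have h3 : (squareData N).Step x (fwdConf N x (Gauge.conf x (.compare r) v 0))
      (bwdConf N x (Gauge.conf x (.compare r) v 0)) := by
    have h4 : bwdConf N x (Gauge.conf x (.compare r) v 0) =
        enterState x (inl (bwd (.compare r))) (v : ℤ) ((0 : ℕ) : TapePos x) := by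
      simp only [bwdConf, enterState, SquareState.count, SquareState.move, HeadMove.shift_reverse,
        SignType.coe_neg, sub_eq_add_neg, Int.cast_neg]
    rw [h4]
    refine step_of_next (by simp) ?_
    rw [hx.leftEnd, counterStatus_pos hv]
    rfl
  refine ((h1.tail h3).trans h2).of_eq (by ring) ?_
  simp [bwdConf, Gauge.count, Gauge.move, HeadMove.shift]

theorem steps_skipA (hx : ∀ k, 0 < k → k ≤ m → tapeSymAt x (k : TapePos x) = .letter .a) :
    IterRel ((squareData N).Step x) (m + 1) (natConf N x (inl start) 0 0)
      (natConf N x (inl skipA) 0 (m + 1)) := by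
  have h : ∀ d ≤ m, IterRel ((squareData N).Step x) (d + 1) (natConf N x (inl start) 0 0)
      (natConf N x (inl skipA) 0 (d + 1)) := by
    intro d hd
    induction d with
    | zero => exact IterRel.single (step_natConf (by simp) (tapeSymAt_zero x) rfl rfl rfl rfl)
    | succ d ih =>
      refine (ih (by omega)).tail (step_natConf (by simp) (hx _ (by omega) (by omega)) rfl rfl rfl ?_)
      simp [SquareState.move, HeadMove.shift]
  exact h m le_rfl

theorem steps_probe (hm : 0 < m)
    (hx : ∀ k, 0 < k → k ≤ m → tapeSymAt x (k : TapePos x) = .letter .a)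
    (hx' : ∀ k, m < k → k ≤ m + n → tapeSymAt x (k : TapePos x) = .letter .b) (hn : 0 < n) :
    IterRel ((squareData N).Step x) (m + n + 3) (natConf N x (inl start) 0 0)
      (natConf N x (inl skipB) 1 (m + n + 1)) := by
  have h1 : (squareData N).Step x (natConf N x (inl skipA) 0 (m + 1))
      (natConf N x (inl probe) 1 m) := by
    refine step_natConf (by simp) (hx' _ (by omega) (by omega)) rfl rfl rfl ?_
    simp [SquareState.move, HeadMove.shift]
  have h2 : (squareData N).Step x (natConf N x (inl probe) 1 m)
      (natConf N x (inl skipB) 1 (m + 1)) :=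
    step_natConf (by simp) (hx _ (by omega) (by omega)) (counterStatus_pos one_pos) rfl rfl rfl
  have h3 : ∀ d ≤ n, IterRel ((squareData N).Step x) d (natConf N x (inl skipB) 1 (m + 1))
      (natConf N x (inl skipB) 1 (m + d + 1)) := by
    intro d hd
    induction d with
    | zero => exact IterRel.refl _
    | succ d ih =>
      refine (ih (by omega)).tail (step_natConf (by simp) (hx' _ (by omega) (by omega))
        (counterStatus_pos one_pos) rfl rfl ?_)
      simp [SquareState.move, HeadMove.shift]
      ring
  exact ((((steps_skipA hx).tail h1).tail h2).trans (h3 n le_rfl)).of_eq (by ring) rfl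

theorem steps_format (hx : IsBlockTape x m n) (hm : 0 < m) (hn : 0 < n) :
    IterRel ((squareData N).Step x) (m + n + 4) (natConf N x (inl start) 0 0)
      (natConf N x (inl (fwd .enter)) 1 (m + n)) := by
  refine (steps_probe hm hx.lettersA hx.lettersB hn).tail (step_natConf (by simp) hx.rightEnd
    (counterStatus_pos one_pos) rfl rfl ?_)
  simp [SquareState.move, Gauge.move, HeadMove.shift]

/-- The part of a clock period before the restart. In the uses below the configuration changes only
by the clock value here, and the restart at `0` moves the head. -/
theorem steps_wait {κ : Type} {r : κ → κ → Prop} {w : Fin N} (f : Fin N → κ)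
    (h : ∀ i i', tick w i = some i' → i' ≠ 0 → r (f i) (f i')) : IterRel r w (f 0) (f w) := by
  have h1 : ∀ d (hd : d ≤ w.1), IterRel r d (f 0) (f ⟨d, lt_of_le_of_lt hd w.2⟩) := by
    intro d hd
    induction d with
    | zero => exact IterRel.refl _
    | succ d ih =>
      refine (ih (by omega)).tail (h _ _ ?_ ?_)
      · have hlt : (⟨d, (Nat.lt_of_succ_le hd).trans w.2⟩ : Fin N) < w := hd
        rw [tick, dif_pos hlt]
      · intro h
        have := congrArg Fin.val h
        simp at this
  exact h1 w le_rfl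

variable {j : Fin N}

theorem steps_scan_letter {k : ℕ} {l : AB} (hk : tapeSymAt x ((k + 1 : ℕ) : TapePos x) = .letter l) :
    IterRel ((squareData N).Step x) (j + 1) (natConf N x (inl (scan j 0)) 0 (k + 1))
      (natConf N x (inl (scan j 0)) 0 k) := by
  have hn : ∀ i i', tick j i = some i' →
      SquareState.next (.letter l) 0 (inl (scan j i)) = some (inl (scan j i')) := by
    intro i i' h
    cases l <;> simp [SquareState.next, h]
  refine (steps_wait (fun i => natConf N x (inl (scan j i)) 0 (k + 1)) fun i i' h h0 =>
    step_natConf (by simp) hk rfl (hn _ _ h) rfl ?_).tail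
    (step_natConf (by simp) hk rfl (hn _ _ (tick_self j)) rfl ?_)
  · simp [SquareState.move, h0, HeadMove.shift]
  · simp [SquareState.move, HeadMove.shift]

theorem steps_scan (hx : IsBlockTape x m n) :
    IterRel ((squareData N).Step x) ((m + n) * (j + 1)) (natConf N x (inl (scan j 0)) 0 (m + n))
      (natConf N x (inl (scan j 0)) 0 0) := by
  have h : ∀ d ≤ m + n, IterRel ((squareData N).Step x) (d * (j + 1))
      (natConf N x (inl (scan j 0)) 0 d) (natConf N x (inl (scan j 0)) 0 0) := by
    intro d hd
    induction d with
    | zero => exact (IterRel.refl _).of_eq (by simp) rfl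
    | succ d ih =>
      have hl : ∃ l, tapeSymAt x ((d + 1 : ℕ) : TapePos x) = .letter l := by
        rcases le_or_gt (d + 1) m with h | h
        · exact ⟨_, hx.lettersA _ (by omega) h⟩
        · exact ⟨_, hx.lettersB _ h hd⟩
      obtain ⟨l, hl⟩ := hl
      exact ((steps_scan_letter hl).trans (ih (by omega))).of_eq (by ring) rfl
  exact h (m + n) le_rfl

theorem steps_back (hx : IsBlockTape x m n) (hn : 0 < n) :
    IterRel ((squareData N).Step x) (m + 2) (natConf N x (inl (scan j 0)) 0 0)
      (natConf N x (inl (bump j)) 1 (m + 1)) := by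
  have h : ∀ d ≤ m, IterRel ((squareData N).Step x) (d + 1) (natConf N x (inl (scan j 0)) 0 0)
      (natConf N x (inl (back j)) 0 (d + 1)) := by
    intro d hd
    induction d with
    | zero => exact IterRel.single (step_natConf (by simp) hx.leftEnd rfl rfl rfl rfl)
    | succ d ih =>
      refine (ih (by omega)).tail (step_natConf (by simp) (hx.lettersA _ (by omega) (by omega)) rfl
        rfl rfl ?_)
      simp [SquareState.move, HeadMove.shift]
  refine (h m le_rfl).tail (step_natConf (by simp) (hx.lettersB _ (by omega) (by omega)) rfl
    rfl rfl ?_)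
  simp [SquareState.move, HeadMove.shift]

theorem steps_down_letter {v k : ℕ} (hk : tapeSymAt x ((k + 1 : ℕ) : TapePos x) = .letter .a) :
    IterRel ((squareData N).Step x) (j.rev + 1) (natConf N x (inl (down j 0)) (v + 1) (k + 1))
      (natConf N x (inl (down j 0)) v k) := by
  have hn : ∀ i i', tick j.rev i = some i' →
      SquareState.next (.letter .a) 1 (inl (down j i)) = some (inl (down j i')) := by
    intro i i' h
    simp [SquareState.next, h]
  refine (steps_wait (fun i => natConf N x (inl (down j i)) (v + 1) (k + 1)) fun i i' h h0 =>
    step_natConf (by simp) hk (counterStatus_pos v.succ_pos) (hn _ _ h) ?_ ?_).tail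
    (step_natConf (by simp) hk (counterStatus_pos v.succ_pos) (hn _ _ (tick_self _)) ?_ ?_)
  · simp [SquareState.count, h0]
  · simp [SquareState.move, h0, HeadMove.shift]
  · simp [SquareState.count]
  · simp [SquareState.move, HeadMove.shift]

theorem steps_down_bottom {k : ℕ} (hk : tapeSymAt x (k : TapePos x) = .letter .a) :
    IterRel ((squareData N).Step x) (j.rev + 1) (natConf N x (inl (down j 0)) 0 k)
      (natConf N x (inl (up j 0)) 1 (k + 1)) := by
  have hn : ∀ i i', tick j.rev i = some i' → i' ≠ 0 →
      SquareState.next (.letter .a) 0 (inl (down j i)) = some (inl (down j i')) := by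
    intro i i' h h0
    have : i ≠ j.rev := by
      rintro rfl
      rw [tick_self] at h
      exact h0 (Option.some.inj h).symm
    simp [SquareState.next, h, this]
  have hn' : SquareState.next (.letter .a) 0 (inl (down j j.rev)) = some (inl (up j 0)) := by
    simp [SquareState.next]
  refine (steps_wait (fun i => natConf N x (inl (down j i)) 0 k) fun i i' h h0 =>
    step_natConf (by simp) hk rfl (hn _ _ h h0) ?_ ?_).tail
    (step_natConf (by simp) hk rfl hn' ?_ ?_)
  · simp [SquareState.count, h0]
  · simp [SquareState.move, h0, HeadMove.shift]
  · simp [SquareState.count]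
  · simp [SquareState.move, HeadMove.shift]

theorem steps_up_letter {v k : ℕ} (hv : 0 < v) (hk : tapeSymAt x (k : TapePos x) = .letter .a) :
    IterRel ((squareData N).Step x) (j.rev + 1) (natConf N x (inl (up j 0)) v k)
      (natConf N x (inl (up j 0)) (v + 1) (k + 1)) := by
  have hn : ∀ i i', tick j.rev i = some i' →
      SquareState.next (.letter .a) 1 (inl (up j i)) = some (inl (up j i')) := by
    intro i i' h
    simp [SquareState.next, h]
  refine (steps_wait (fun i => natConf N x (inl (up j i)) v k) fun i i' h h0 =>
    step_natConf (by simp) hk (counterStatus_pos hv) (hn _ _ h) ?_ ?_).tail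
    (step_natConf (by simp) hk (counterStatus_pos hv) (hn _ _ (tick_self _)) ?_ ?_)
  · simp [SquareState.count, h0]
  · simp [SquareState.move, h0, HeadMove.shift]
  · simp [SquareState.count]
  · simp [SquareState.move, HeadMove.shift]

theorem steps_down (hx : IsBlockTape x m n) (d : ℕ) : ∀ v k, k + d ≤ m →
    IterRel ((squareData N).Step x) (d * (j.rev + 1)) (natConf N x (inl (down j 0)) (v + d) (k + d))
      (natConf N x (inl (down j 0)) v k) := by
  induction d with
  | zero => exact fun v k _ => (IterRel.refl _).of_eq (by simp) rfl
  | succ d ih =>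
    intro v k h
    exact ((steps_down_letter (hx.lettersA _ (by omega) (by omega))).trans
      (ih v k (by omega))).of_eq (by ring) rfl

theorem steps_up (hx : IsBlockTape x m n) (d : ℕ) : ∀ v k, 0 < v → 0 < k → k + d ≤ m + 1 →
    IterRel ((squareData N).Step x) (d * (j.rev + 1)) (natConf N x (inl (up j 0)) v k)
      (natConf N x (inl (up j 0)) (v + d) (k + d)) := by
  induction d with
  | zero => exact fun v k _ _ _ => (IterRel.refl _).of_eq (by simp) rfl
  | succ d ih =>
    intro v k hv hk h
    exact ((ih v k hv hk (by omega)).trans (steps_up_letter (by omega)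
      (hx.lettersA _ (by omega) (by omega)))).of_eq (by ring) rfl

theorem step_bump (hx : IsBlockTape x m n) (hn : 0 < n) (v : ℕ) :
    (squareData N).Step x (natConf N x (inl (bump j)) (v + 1) (m + 1))
      (natConf N x (inl (down j 0)) v m) := by
  refine step_natConf (by simp) (hx.lettersB _ (by omega) (by omega)) (counterStatus_pos v.succ_pos)
    rfl ?_ ?_
  · simp [SquareState.count]
  · simp [SquareState.move, HeadMove.shift]

/-- The round that starts with counter `i + 1` visits `i` letters downwards, one at the bottom and
`i` upwards; the odd numbers `2 * i + 1` sum to a square. -/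
theorem steps_loop (hx : IsBlockTape x m n) (hn : 0 < n) (i : ℕ) (hi : i ≤ m) :
    IterRel ((squareData N).Step x) (2 * i + i ^ 2 * (j.rev + 1))
      (natConf N x (inl (bump j)) 1 (m + 1)) (natConf N x (inl (bump j)) (i + 1) (m + 1)) := by
  induction i with
  | zero => exact (IterRel.refl _).of_eq (by simp) rfl
  | succ i ih =>
    have h1 := (ih (by omega)).tail (step_bump hx hn i)
    have h2 := steps_down (N := N) (j := j) hx i 0 (m - i) (by omega)
    rw [zero_add, Nat.sub_add_cancel (by omega)] at h2
    have h3 := steps_down_bottom (N := N) (j := j) (hx.lettersA (m - i) (by omega) (by omega))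
    have h4 := steps_up (N := N) (j := j) hx i 1 (m - i + 1) (by omega) (by omega) (by omega)
    rw [show m - i + 1 + i = m + 1 by omega, add_comm 1 i] at h4
    have h5 : (squareData N).Step x (natConf N x (inl (up j 0)) (i + 1) (m + 1))
        (natConf N x (inl (bump j)) (i + 1 + 1) (m + 1)) := by
      refine step_natConf (by simp) (hx.lettersB _ (by omega) (by omega))
        (counterStatus_pos i.succ_pos) rfl ?_ ?_
      · simp [SquareState.count]
      · simp [SquareState.move, HeadMove.shift]
    exact ((((h1.trans h2).trans h3).trans h4).tail h5).of_eq (by ring) rfl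

/-- The running time of branch `j`, up to the final interference. -/
def branchTime (N m n : ℕ) (j : Fin N) : ℕ :=
  (m + n) * (j + 1) + (m ^ 2 + m) * (j.rev + 1) + (3 * m + 4)

/-- After `m` loops the next descent reaches the left end-marker with counter zero, which ends the
branch. Its `m` extra letter visits balance the `m` letters `a` of the sweep by `scan`. -/
theorem steps_branch (hx : IsBlockTape x m n) (hn : 0 < n) :
    IterRel ((squareData N).Step x) (branchTime N m n j)
      (natConf N x (inr (split, j)) 0 (m + n + 1)) (natConf N x (inl (down j 0)) 0 0) := by
  have h1 : (squareData N).Step x (natConf N x (inr (split, j)) 0 (m + n + 1))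
      (natConf N x (inl (scan j 0)) 0 (m + n)) := by
    refine step_natConf (by simp) hx.rightEnd rfl rfl rfl ?_
    simp [SquareState.move, HeadMove.shift]
  have h2 := steps_down (N := N) (j := j) hx m 0 0 (by omega)
  rw [zero_add] at h2
  exact ((((((IterRel.single h1).trans (steps_scan hx)).trans (steps_back hx hn)).trans
    (steps_loop hx hn m le_rfl)).tail (step_bump hx hn m)).trans h2).of_eq
    (by rw [branchTime]; ring) rfl

end Runs

/-! ### Outcome probabilities and time bounds for each input. -/

section Result

open Core Coin Sum QCounterData

variable {N : ℕ} [NeZero N] {x : List AB} {m n : ℕ}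

theorem natConf_start :
    natConf N x (inl start) 0 0 = ((squareData N).q₀, 0, 0) := by
  simp [natConf]

theorem natConf_inr_injective (g : Coin) (v k : ℕ) :
    Function.Injective fun l : Fin N => natConf N x (inr (g, l)) v k := by
  intro l l' h
  have := congrArg Prod.fst h
  simpa using this

theorem inr_mem_squareAcc {g : Coin} (hg : g ≠ split) (l : Fin N) :
    (inr (g, l) : SquareState N) ∈ squareAcc N ↔ l = 0 := by
  constructor
  · rintro ⟨g', _, h⟩
    exact congrArg Prod.snd (inr.inj h)
  · rintro rfl
    exact ⟨g, hg, rfl⟩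

theorem inr_mem_squareRej {g : Coin} (hg : g ≠ split) (l : Fin N) :
    (inr (g, l) : SquareState N) ∈ squareRej N ↔ l ≠ 0 := by
  constructor
  · rintro (h | ⟨g', l', _, hl, h⟩)
    · cases h
    · exact fun h0 => hl ((congrArg Prod.snd (inr.inj h)).symm.trans h0)
  · exact fun hl => Or.inr ⟨g, l, hg, hl, rfl⟩

theorem haltsAs_coin {q : SquareState N} {v k : ℕ} {σ : TapeSym AB} {s : Fin 2} {g : Coin}
    (hσ : tapeSymAt x (k : TapePos x) = σ) (hs : counterStatus (v : ℤ) = s) (hg : g ≠ split)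
    {j : Fin N} (h : SquareState.next σ s q = some (inr (g, j))) :
    (squareData N).HaltsAs x (Finsupp.single (natConf N x q v k) 1) 1 (fun _ : Unit => 0)
      (fun _ => ∑ l, Finsupp.single (natConf N x (inr (g, l)) v k) (uniformReflection N l j)) := by
  have h1 := evolve_of_next_inr (x := x) (a := (v : ℤ)) (b := (k : TapePos x)) (q := q) (g := g)
    (i := j) (by rw [hσ, hs, h])
  have h2 : ∀ l : Fin N, enterState x (inr (g, l)) (v : ℤ) (k : TapePos x) =
      natConf N x (inr (g, l)) v k := by
    intro l
    cases g with
    | split => exact absurd rfl hg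
    | _ =>
      refine enterState_eq_natConf ?_ ?_
      · simp [SquareState.count]
      · simp [SquareState.move, HeadMove.shift]
  simp only [h2] at h1
  refine HaltsAs.of_evolve h1 fun l => ?_
  by_cases hl : l = 0
  · exact Or.inl ((inr_mem_squareAcc hg l).2 hl)
  · exact Or.inr ((inr_mem_squareRej hg l).2 hl)

theorem weight_rej_coin (hN : 2 ≤ N) {g : Coin} (hg : g ≠ split) (v k : ℕ) (α : ℂ) (j : Fin N) :
    weight (M := squareData N) (x := x) (squareData N).rej
      (α • ∑ l, Finsupp.single (natConf N x (inr (g, l)) v k) (uniformReflection N l j)) =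
        ‖α‖ ^ 2 * (1 - 1 / N) := by
  simp only [Finset.smul_sum, Finsupp.smul_single, smul_eq_mul]
  rw [weight_sum_single _ (natConf_inr_injective g v k), ← sum_norm_sq_uniformReflection_ne_zero hN j,
    Finset.mul_sum]
  refine Finset.sum_congr rfl fun l _ => ?_
  have : (natConf N x (inr (g, l)) v k).1 ∈ (squareData N).rej ↔ l ≠ 0 := inr_mem_squareRej hg l
  by_cases hl : l = 0
  · rw [if_neg (by rw [this]; simpa using hl), if_pos hl, mul_zero]
  · rw [if_pos (this.2 hl), if_neg hl, norm_mul, mul_pow]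

/-- A run that ends in the state `fail`. -/
theorem rejects_of_fail {T v k : ℕ} {q : SquareState N} {σ : TapeSym AB} {s : Fin 2}
    (hT : IterRel ((squareData N).Step x) T (natConf N x (inl start) 0 0) (natConf N x q v k))
    (hσ : tapeSymAt x (k : TapePos x) = σ) (hs : counterStatus (v : ℤ) = s)
    (h : SquareState.next σ s q = some (inl fail)) :
    (squareData N).RejectsWithProb x 1 ∧
      ∀ T', T + 1 ≤ T' → (squareData N).HaltsWithin x T' := by
  have hrej : (inl fail : SquareState N) ∈ squareRej N := Or.inl rfl
  have h1 := evolve_of_next_inl (x := x) (a := (v : ℤ)) (b := (k : TapePos x)) (q := q)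
    (by rw [hσ, hs, h])
  have h2 : (squareData N).HaltsAs x (Finsupp.single (natConf N x q v k) 1) 1 (fun _ : Unit => 0)
      (fun _ => ∑ _l : Unit, Finsupp.single (enterState x (inl fail) (v : ℤ) (k : TapePos x)) 1) :=
    HaltsAs.of_evolve (by simpa using h1) fun _ => Or.inr hrej
  have h3 := h2.of_steps hT
  rw [natConf_start] at h3
  refine ⟨?_, fun T' hT' => h3.haltsWithin (by omega)⟩
  have h4 := h3.rejectsWithProb fun _ _ _ => rfl
  rw [Fintype.sum_unique, weight_sum_single _ (fun _ _ _ => rfl)] at h4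
  simpa [enterState, hrej] using h4

/-- A run in which the gauge computation shows that the first block is too long. -/
theorem rejects_of_short (hN : 2 ≤ N) {T k : ℕ} {r : ZMod 12}
    (hT : IterRel ((squareData N).Step x) T (natConf N x (inl start) 0 0)
      (natConf N x (inl (fwd (.compare r))) 0 k))
    (hσ : tapeSymAt x (k : TapePos x) = .leftEnd ∨ tapeSymAt x (k : TapePos x) = .letter .a) :
    (squareData N).RejectsWithProb x (1 - 1 / N) ∧
      ∀ T', T + 1 ≤ T' → (squareData N).HaltsWithin x T' := by
  have hg : short r ≠ split := by simp
  have h2 : (squareData N).HaltsAs x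
      (Finsupp.single (natConf N x (inl (fwd (.compare r))) 0 k) 1) 1 (fun _ : Unit => 0)
      (fun _ => ∑ l, Finsupp.single (natConf N x (inr (short r, l)) 0 k)
        (uniformReflection N l 0)) := by
    rcases hσ with hσ | hσ
    · exact haltsAs_coin hσ counterStatus_zero hg rfl
    · exact haltsAs_coin hσ counterStatus_zero hg rfl
  have h3 := h2.of_steps hT
  rw [natConf_start] at h3
  refine ⟨?_, fun T' hT' => h3.haltsWithin (by omega)⟩
  have h4 := h3.rejectsWithProb fun _ _ _ => rfl
  have h5 := weight_rej_coin (x := x) hN hg 0 k 1 0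
  rw [one_smul, norm_one, one_pow, one_mul] at h5
  rwa [Fintype.sum_unique, h5] at h4

/-- The branches start, run independently of each other and interfere at their ends. -/
theorem haltsAs_branches (hx : IsBlockTape x m n) (hn : 0 < n) {B : ℕ}
    (hB : ∀ j : Fin N, branchTime N m n j ≤ B) :
    (squareData N).HaltsAs x (Finsupp.single (natConf N x (inl (bwd .enter)) 1 (m + n + 1)) 1)
      (B + 1 + 1) (fun j : Fin N => branchTime N m n j + 1)
      (fun j => uniformReflection N j 0 •
        ∑ l, Finsupp.single (natConf N x (inr (final, l)) 0 0) (uniformReflection N l j)) := by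
  classical
  have h1 : ∀ j : Fin N, (squareData N).HaltsAs x
      (Finsupp.single (natConf N x (inr (split, j)) 0 (m + n + 1)) 1) (B + 1)
      (fun _ : Unit => branchTime N m n j) (fun _ => ∑ l,
        Finsupp.single (natConf N x (inr (final, l)) 0 0) (uniformReflection N l j)) := by
    intro j
    have h := (haltsAs_coin (q := inl (down j 0)) (g := final) (j := j) hx.leftEnd
      counterStatus_zero (by simp) (by simp [SquareState.next])).of_steps (steps_branch hx hn)
    simp only [zero_add] at h
    exact h.mono (by have := hB j; omega)
  have h2 := evolve_of_next_inr (x := x) (a := ((1 : ℕ) : ℤ)) (b := ((m + n + 1 : ℕ) : TapePos x))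
    (q := (inl (bwd .enter) : SquareState N)) (g := split) (i := 0)
    (by rw [hx.rightEnd, counterStatus_pos one_pos]; rfl)
  have h3 : ∀ l : Fin N, enterState x (inr (split, l)) ((1 : ℕ) : ℤ) ((m + n + 1 : ℕ) : TapePos x) =
      natConf N x (inr (split, l)) 0 (m + n + 1) := fun l =>
    enterState_eq_natConf (by simp [SquareState.count]) (by simp [SquareState.move, HeadMove.shift])
  simp only [h3] at h2
  have hacc : ∀ l : Fin N, (inr (split, l) : SquareState N) ∉ squareAcc N := by
    rintro l ⟨g, hg, h⟩
    exact hg (congrArg Prod.fst (inr.inj h)).symm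
  have hrej : ∀ l : Fin N, (inr (split, l) : SquareState N) ∉ squareRej N := by
    rintro l (h | ⟨g, l', hg, _, h⟩)
    · cases h
    · exact hg (congrArg Prod.fst (inr.inj h)).symm
  have h4 : ∀ κ : (squareData N).Config x, (squareData N).evolve x
      (Finsupp.single (natConf N x (inl (bwd .enter)) 1 (m + n + 1)) 1) κ ≠ 0 →
      κ.1 ∉ squareAcc N ∧ κ.1 ∉ squareRej N := by
    intro κ hκ
    by_contra hne
    apply hκ
    rw [h2, Finsupp.finsetSum_apply]
    refine Finset.sum_eq_zero fun l _ => Finsupp.single_eq_of_ne ?_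
    rintro rfl
    exact hne ⟨hacc l, hrej l⟩
  refine (HaltsAs.sum (fun j => uniformReflection N j 0) h1).step ?_ ?_
  · change ((squareData N).evolve x _).filter _ = 0
    rw [Finsupp.filter_eq_zero_iff]
    intro κ hκ
    by_contra h
    exact hκ.elim (h4 κ h).1 (h4 κ h).2
  · change ((squareData N).evolve x _).filter _ = _
    rw [(Finsupp.filter_eq_self_iff _ _).2 h4, h2]
    simp

/-- The amplitude of outcome `0` is a sum of `N` products `(1 / √N) * (1 / √N)`, hence `1`; no other
outcome accepts. -/
theorem weight_acc_branches (hN : 2 ≤ N) :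
    weight (M := squareData N) (x := x) (squareData N).acc
      (∑ j, uniformReflection N j 0 •
        ∑ l, Finsupp.single (natConf N x (inr (final, l)) 0 0) (uniformReflection N l j)) = 1 := by
  have h : ∑ j, uniformReflection N j 0 •
      ∑ l, Finsupp.single (natConf N x (inr (final, l)) 0 0) (uniformReflection N l j) =
      ∑ l, Finsupp.single (natConf N x (inr (final, l)) 0 0)
        (∑ j, uniformReflection N j 0 * uniformReflection N l j) := by
    simp only [Finset.smul_sum, Finsupp.smul_single, smul_eq_mul, Finsupp.single_finsetSum]
    exact Finset.sum_comm
  rw [h, weight_sum_single _ (natConf_inr_injective final 0 0), Fintype.sum_eq_single 0]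
  · rw [if_pos ((inr_mem_squareAcc (by simp) 0).2 rfl)]
    simp only [uniformReflection_apply_zero hN, uniformReflection_zero_apply hN, Finset.sum_const,
      Finset.card_univ, Fintype.card_fin, nsmul_eq_mul]
    have hc := norm_sq_inv_sqrt (N := N)
    rw [norm_mul, norm_mul, ← sq, hc, Complex.norm_natCast, mul_one_div_cancel, one_pow]
    exact Nat.cast_ne_zero.2 (NeZero.ne N)
  · intro l hl
    exact if_neg fun h => hl ((inr_mem_squareAcc (by simp) l).1 h)

theorem branchTime_le (N m n : ℕ) (j : Fin N) :
    branchTime N m n j ≤ (m + n) * N + (m ^ 2 + m) * N + (3 * m + 4) := by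
  have h1 : j.1 + 1 ≤ N := j.2
  have h2 : j.rev.1 + 1 ≤ N := j.rev.2
  rw [branchTime]
  gcongr

theorem branchTime_sq (N m : ℕ) (j : Fin N) :
    branchTime N m (m ^ 2) j = (m ^ 2 + m) * (N + 1) + (3 * m + 4) := by
  have : N + 1 = (j + 1) + (j.rev + 1) := by
    rw [Fin.val_rev]
    omega
  rw [branchTime, this]
  ring

/-- The time is affine in `j` with slope `(m + n) - (m ^ 2 + m) = n - m ^ 2`. -/
theorem branchTime_injective {N m n : ℕ} (h : n ≠ m ^ 2) : Function.Injective (branchTime N m n) := by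
  intro j j' hj
  have h1 : (j.rev : ℤ) = N - 1 - j := by rw [Fin.val_rev]; omega
  have h2 : (j'.rev : ℤ) = N - 1 - j' := by rw [Fin.val_rev]; omega
  have h3 := congrArg (Nat.cast : ℕ → ℤ) hj
  simp only [branchTime] at h3
  push_cast [h1, h2] at h3
  have h4 : ((n : ℤ) - m ^ 2) * (j - j') = 0 := by linear_combination h3
  rcases mul_eq_zero.1 h4 with h5 | h5
  · exact absurd (by exact_mod_cast sub_eq_zero.1 h5) h
  · exact Fin.ext (by exact_mod_cast sub_eq_zero.1 h5)

/-- The behaviour of the automaton on `a ^ m b ^ n`. -/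
theorem squareData_wordAB (hN : 2 ≤ N) (hx : IsBlockTape x m n) (hm : 0 < m) (hn : 0 < n) :
    (n = m ^ 2 → (squareData N).AcceptsWithProb x 1) ∧
      (n ≠ m ^ 2 → (squareData N).RejectsWithProb x (1 - 1 / N)) ∧
        (squareData N).HaltsWithin x (100 * N * (m + n)) := by
  obtain ⟨k, T, r, hk1, hk2, hT, h⟩ := Gauge.steps_gauge hx hm hn
  have hf := steps_format (N := N) hx hm hn
  have hNL : 2 * (m + n) ≤ N * (m + n) := Nat.mul_le_mul_right _ hN
  rcases le_or_gt (2 ^ (k + 1)) m with hkm | hkm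
  · have h1 := h.trans (Gauge.steps_compare hx r _ _ le_rfl hkm)
    rw [Nat.sub_self] at h1
    have h2 := hf.trans (h1.map (f := fwdConf N x) fun _ _ => step_fwdConf)
    have hσ : tapeSymAt x ((m - 2 ^ (k + 1) : ℕ) : TapePos x) = .leftEnd ∨
        tapeSymAt x ((m - 2 ^ (k + 1) : ℕ) : TapePos x) = .letter .a := by
      rcases Nat.eq_zero_or_pos (m - 2 ^ (k + 1)) with h0 | h0
      · rw [h0]
        exact Or.inl hx.leftEnd
      · exact Or.inr (hx.lettersA _ h0 (Nat.sub_le _ _))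
    obtain ⟨h3, h4⟩ := rejects_of_short hN h2 hσ
    -- If `n = m ^ 2`, then `2 ^ (k + 1) ≤ m` would give `4 ^ (k + 1) ≤ n`.
    refine ⟨fun hmn => absurd ?_ hk2.not_ge, fun _ => h3, h4 _ ?_⟩
    · rw [hmn, show (4 : ℕ) = 2 ^ 2 by norm_num, ← pow_mul, mul_comm 2, pow_mul]
      exact Nat.pow_le_pow_left hkm 2
    · rw [mul_assoc]
      omega
  · have h1 := h.trans (Gauge.steps_compare hx r _ m hkm.le le_rfl)
    rw [Nat.sub_self] at h1
    have h2 := hf.trans (steps_pass (N := N) hx (Nat.sub_pos_of_lt hkm) h1)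
    have h3 := (haltsAs_branches hx hn (branchTime_le N m n)).of_steps h2
    rw [natConf_start] at h3
    -- This is the purpose of the gauge: it makes the quadratic loop time linear in `n`.
    have hm2 : m ^ 2 ≤ 4 * n := by
      calc m ^ 2 ≤ (2 ^ (k + 1)) ^ 2 := Nat.pow_le_pow_left hkm.le 2
        _ = 4 * 4 ^ k := by
          rw [← pow_mul, mul_comm, pow_mul]
          ring
        _ ≤ 4 * n := Nat.mul_le_mul_left 4 hk1
    refine ⟨fun hmn => ?_, fun hmn => ?_, h3.haltsWithin ?_⟩
    · have h4 := h3.acceptsWithProb ((m ^ 2 + m) * (N + 1) + (3 * m + 4) + 1 + _) fun j => by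
        rw [hmn, branchTime_sq]
      rwa [weight_acc_branches hN] at h4
    · have h4 := h3.rejectsWithProb fun j j' hj => branchTime_injective hmn (by simpa using hj)
      simp only [weight_rej_coin hN (show final ≠ split by simp), uniformReflection_apply_zero hN,
        norm_sq_inv_sqrt, Finset.sum_const, Finset.card_univ, Fintype.card_fin, nsmul_eq_mul] at h4
      rwa [← mul_assoc, mul_one_div_cancel (Nat.cast_ne_zero.2 (NeZero.ne N)), one_mul] at h4
    · have h5 : m ^ 2 * N ≤ 4 * n * N := Nat.mul_le_mul_right _ hm2
      nlinarith

theorem exists_replicate_append (l : AB) (x : List AB) :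
    ∃ m y, x = List.replicate m l ++ y ∧ ∀ l' y', y = l' :: y' → l' ≠ l := by
  induction x with
  | nil => exact ⟨0, [], rfl, by simp⟩
  | cons l₁ x ih =>
    by_cases h : l₁ = l
    · obtain ⟨m, y, rfl, hy⟩ := ih
      exact ⟨m + 1, y, by rw [h, List.replicate_succ, List.cons_append], hy⟩
    · refine ⟨0, l₁ :: x, rfl, ?_⟩
      rintro l' y' ⟨⟩
      exact h

theorem AB.eq_a_of_ne : ∀ {l : AB}, l ≠ .b → l = .a
  | .a, _ => rfl
  | .b, h => absurd rfl h

theorem tapeSymAt_getElem? {l : AB} {k : ℕ} (h : x[k]? = some l) :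
    tapeSymAt x ((k + 1 : ℕ) : TapePos x) = .letter l := by
  obtain ⟨hk, rfl⟩ := List.getElem?_eq_some_iff.1 h
  exact tapeSymAt_succ x hk

/-- The words that are not of the form `a ^ m b ^ n` with `m, n ≥ 1` are rejected at once. -/
theorem squareData_malformed (x : List AB) (hx : ∀ m n, 1 ≤ m → 1 ≤ n → x ≠ wordAB m n) :
    (squareData N).RejectsWithProb x 1 ∧
      ∀ T, x.length + 5 ≤ T → (squareData N).HaltsWithin x T := by
  obtain ⟨m, y, hxy, hy⟩ := exists_replicate_append .a x
  have ha : ∀ k, 0 < k → k ≤ m → tapeSymAt x (k : TapePos x) = .letter .a := by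
    intro k h0 h1
    obtain ⟨k, rfl⟩ : ∃ k', k = k' + 1 := ⟨k - 1, by omega⟩
    refine tapeSymAt_getElem? ?_
    rw [hxy, List.getElem?_append_left (by simpa using h1), List.getElem?_replicate_of_lt h1]
  have hskip := steps_skipA (N := N) ha
  have hlen := congrArg List.length hxy
  rw [List.length_append, List.length_replicate] at hlen
  obtain ⟨n, z, rfl, hz⟩ := exists_replicate_append .b y
  rw [List.length_append, List.length_replicate] at hlen
  have hb : ∀ k, m < k → k ≤ m + n → tapeSymAt x (k : TapePos x) = .letter .b := by
    intro k h0 h1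
    obtain ⟨k, rfl⟩ : ∃ k', k = k' + 1 := ⟨k - 1, by omega⟩
    refine tapeSymAt_getElem? ?_
    rw [hxy, List.getElem?_append_right (by simp; omega), List.getElem?_append_left (by simp; omega),
      List.getElem?_replicate_of_lt (by simp; omega)]
  rcases Nat.eq_zero_or_pos n with rfl | hn
  · rcases z with _ | ⟨l, z⟩
    · have hr := tapeSymAt_length_succ x
      have hl : m = x.length := by simpa using hlen.symm
      rw [hl] at hskip
      obtain ⟨h1, h2⟩ := rejects_of_fail hskip hr counterStatus_zero rfl
      exact ⟨h1, fun T hT => h2 T (by omega)⟩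
    · exact absurd (AB.eq_a_of_ne (hz l z rfl)) (hy l z rfl)
  rcases Nat.eq_zero_or_pos m with rfl | hm
  · have h1 : (squareData N).Step x (natConf N x (inl skipA) 0 (0 + 1))
        (natConf N x (inl probe) 1 0) := by
      refine step_natConf (by simp) (hb _ (by omega) (by omega)) rfl rfl rfl ?_
      simp [SquareState.move, HeadMove.shift]
    obtain ⟨h2, h3⟩ := rejects_of_fail (hskip.tail h1) (tapeSymAt_zero x)
      (counterStatus_pos one_pos) rfl
    exact ⟨h2, fun T hT => h3 T (by omega)⟩
  rcases z with _ | ⟨l, z⟩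
  · rw [List.append_nil] at hxy
    exact absurd hxy (hx m n hm hn)
  · have hl := AB.eq_a_of_ne (hz l z rfl)
    have h1 : tapeSymAt x ((m + n + 1 : ℕ) : TapePos x) = .letter .a := by
      refine tapeSymAt_getElem? ?_
      rw [hxy, ← List.append_assoc, List.getElem?_append_right (by simp)]
      simp [hl]
    obtain ⟨h2, h3⟩ := rejects_of_fail (steps_probe (N := N) hm ha hb hn) h1
      (counterStatus_pos one_pos) rfl
    rw [List.length_cons] at hlen
    exact ⟨h2, fun T hT => h3 T (by omega)⟩

end Result

theorem proposition13 :
    ∃ K : ℕ, ∀ N : ℕ, 2 ≤ N → ∃ M : TwoQ1CA AB,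
      (∀ x ∈ squareLanguage, M.AcceptsWithProb x 1) ∧
      (∀ x ∉ squareLanguage, ∃ p : ℝ, 1 - 1 / (N : ℝ) ≤ p ∧ M.RejectsWithProb x p) ∧
      (∀ m n : ℕ, 1 ≤ m → 1 ≤ n → n ≠ m ^ 2 →
        M.RejectsWithProb (wordAB m n) (1 - 1 / (N : ℝ))) ∧
      (∀ x : List AB, M.HaltsWithin x (K * N * max x.length 1)) := by
  -- A generous bound: the gauge and its reversal cost about `118 * n ≤ 59 * N * n`, and the
  -- branches about `N * (2 * m + 5 * n)`.
  refine ⟨100, fun N hN => ?_⟩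
  have : NeZero N := ⟨by omega⟩
  have hw := fun m n (hm : 1 ≤ m) (hn : 1 ≤ n) =>
    squareData_wordAB hN (isBlockTape_wordAB m n) hm hn
  refine ⟨squareAutomaton hN, ?_, ?_, fun m n hm hn => (hw m n hm hn).2.1, fun x => ?_⟩
  · rintro x ⟨m, hm, rfl⟩
    exact (hw m (m ^ 2) hm (Nat.one_le_pow _ _ hm)).1 rfl
  · intro x hx
    by_cases h : ∃ m n, 1 ≤ m ∧ 1 ≤ n ∧ x = wordAB m n
    · obtain ⟨m, n, hm, hn, rfl⟩ := h
      refine ⟨_, le_rfl, (hw m n hm hn).2.1 ?_⟩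
      rintro rfl
      exact hx ⟨m, hm, rfl⟩
    · push Not at h
      exact ⟨1, sub_le_self _ (by positivity), (squareData_malformed x h).1⟩
  · by_cases h : ∃ m n, 1 ≤ m ∧ 1 ≤ n ∧ x = wordAB m n
    · obtain ⟨m, n, hm, hn, rfl⟩ := h
      have hl : max (wordAB m n).length 1 = m + n := by
        simp [wordAB]
        omega
      rw [hl]
      exact (hw m n hm hn).2.2
    · push Not at h
      refine (squareData_malformed x h).2 _ ?_
      have : 2 * max x.length 1 ≤ N * max x.length 1 := Nat.mul_le_mul_right _ hN
      rw [mul_assoc]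
      omega
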